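/- Work in $\mathbb R^n$, $n\ge 1$, with Lebesgue measure $|\cdot|$. A cube is a half-open cube $\prod_{i=1}^n[x_i-h,x_i+h)$, $h>0$. A dyadic lattice $\mathscr D$ is a collection of cubes such that (i) if $Q\in\mathscr D$, then all cubes obtained from $Q$ by repeated subdivision into $2^n$ congruent subcubes are in $\mathscr D$; (ii) any two cubes of $\mathscr D$ are obtained in this way from a common cube of $\mathscr D$; (iii) every compact set is contained in a cube of $\mathscr D$. A family $\mathcal S$ of cubes is $\eta$-sparse ($0<\eta<1$) if there are pairwise disjoint measurable sets $E_Q\subset Q$ ($Q\in\mathcal S$) with $|E_Q|\ge\eta|Q|$. A weight is a locally integrable function on $\mathbb R^n$ that is positive almost everywhere. For a measurable $w\ge 0$ write $w(Q)=\int_Q w$ and $\langle f\rangle_{r,Q}=\big(\frac1{|Q|}\int_Q f^r\big)^{1/r}$; write $[w]_{A_\infty}=\sup_Q \frac1{w(Q)}\int_Q M(w\chi_Q)$ with the supremum over all cubes and $M$ the Hardy--Littlewood maximal operator over cubes (and $[w]_{A_\infty}=\infty$ if $w$ is not locally integrable). For real $a,b,c$ and a family $\mathcal S$ of cubes let $$[u,v]_{A^{a}_{b,c}(\mathcal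 S)}=\sup_{Q\in\mathcal S}|Q|^{a}\,u(Q)^{b}\,v(Q)^{c},$$ and say $(u,v)\in A^{a}_{b,c}(\mathcal S)$ if this is finite. Let $1\le p\le q<s\le\infty$, $0<r<p$, $\frac1p-\frac1q\le\alpha<\frac1r-\frac1s$ and $0<\eta<1$. There is a constant $C<\infty$ depending only on $n,r,p,q,s,\alpha,\eta$ such that the following holds for every dyadic lattice $\mathscr D$, every $\eta$-sparse family $\mathcal S\subset\mathscr D$ and all weights $\omega,\sigma$. Let $\mathcal N\in[0,\infty]$ be the best constant such that for all $f\in L^p(\omega)$ and $g\in L^{q'}(\sigma)$ $$\sum_{Q\in\mathcal S}\langle|f|\rangle_{r,Q}\,\langle|g|\rangle_{s',Q}\,|Q|^{1+\alpha}\le\mathcal N\,\|f\|_{L^p(\omega)}\|g\|_{L^{q'}(\sigma)},$$ and put $u=\omega^{\frac{r}{r-p}}$ and $v=\sigma^{\frac{s'}{s'-q'}}$ (so $v=1$ if $q=1$). If $\mathcal N<\infty$, then $(u,v)\in A^{\alpha-\frac1r+\frac1s}_{\frac1r-\frac1p,\frac1q-\frac1s}(\mathcal S)$. Moreover, with $[u,v]=[u,v]_{A^{\alpha-1/r+1/s}_{1/r-1/p,\,1/q-1/s}(\mathcal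 S)}$, $$[u,v]\le\mathcal N\le C\,[u,v]\cdot\begin{cases}[u]_{A_\infty}^{1-\frac1{(p')^2}}[v]_{A_\infty}^{\frac1{(p')^2}}+[u]_{A_\infty}^{\frac1{p^2}}[v]_{A_\infty}^{1-\frac1{p^2}}&\text{if }p=q,\ \alpha>0,\\[4pt][u]_{A_\infty}^{\frac1q}+[v]_{A_\infty}^{\frac1{p'}}&\text{otherwise,}\end{cases}$$ where the inequalities are in $[0,\infty]$, with $\frac1{p'}=0$ if $p=1$, $x^0=1$ for every $x\in[0,\infty]$, and $0\cdot\infty=0$. -/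

import Mathlib

open MeasureTheory
open scoped ENNReal NNReal

noncomputable section

namespace SparseForm

/-- A half-open cube `∏ i, [center i - half, center i + half)` in `ℝⁿ`, with `half > 0`. -/
@[ext]
structure Cube (n : ℕ) where
  center : Fin n → ℝ
  half : ℝ
  half_pos : 0 < half

variable {n : ℕ}

/-- The set of points of a cube. -/
def Cube.toSet (Q : Cube n) : Set (Fin n → ℝ) :=
  {y | ∀ i, Q.center i - Q.half ≤ y i ∧ y i < Q.center i + Q.half}

/-- The Lebesgue measure `|Q|`. -/
def Cube.vol (Q : Cube n) : ℝ≥0∞ := volume Q.toSet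

/-- One of the `2 ^ n` congruent subcubes of `Q` of half the side length. -/
def Cube.child (Q : Cube n) (ε : Fin n → Bool) : Cube n where
  center := fun i => Q.center i + (if ε i then Q.half / 2 else - (Q.half / 2))
  half := Q.half / 2
  half_pos := _root_.half_pos Q.half_pos

/-- `DyadicSub Q₀ Q` says that `Q` is a dyadic cube with respect to `Q₀`: it is obtained from `Q₀`
by finitely many (possibly zero) subdivisions into `2 ^ n` congruent subcubes. -/
inductive DyadicSub (Q₀ : Cube n) : Cube n → Prop
  | self : DyadicSub Q₀ Q₀
  | child {Q : Cube n} (h : DyadicSub Q₀ Q) (ε : Fin n → Bool) : DyadicSub Q₀ (Q.child ε)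

/-- Dyadic lattices in `ℝⁿ`. -/
structure IsDyadicLattice (D : Set (Cube n)) : Prop where
  descendants : ∀ Q ∈ D, ∀ Q', DyadicSub Q Q' → Q' ∈ D
  common_ancestor : ∀ Q ∈ D, ∀ Q' ∈ D, ∃ R ∈ D, DyadicSub R Q ∧ DyadicSub R Q'
  exhaust : ∀ K : Set (Fin n → ℝ), IsCompact K → ∃ Q ∈ D, K ⊆ Q.toSet

/-- `η`-sparse families of cubes: there are pairwise disjoint measurable sets `E Q ⊆ Q`, `Q ∈ S`,
with `|E Q| ≥ η |Q|`. -/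
def IsSparse (η : ℝ) (S : Set (Cube n)) : Prop :=
  ∃ E : Cube n → Set (Fin n → ℝ),
    (∀ Q ∈ S, MeasurableSet (E Q) ∧ E Q ⊆ Q.toSet ∧ ENNReal.ofReal η * Q.vol ≤ volume (E Q)) ∧
    S.PairwiseDisjoint E

/-- A weight on `ℝⁿ`: a locally integrable function that is positive almost everywhere. -/
def IsWeight (w : (Fin n → ℝ) → ℝ) : Prop :=
  LocallyIntegrable w volume ∧ ∀ᵐ x, 0 < w x

/-- The power `w ^ t` of a weight, with values in `[0, ∞]`. -/
def wpow (w : (Fin n → ℝ) → ℝ) (t : ℝ) : (Fin n → ℝ) → ℝ≥0∞ :=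
  fun x => ENNReal.ofReal (w x) ^ t

/-- The mass `w(Q) = ∫_Q w`. -/
def mass (w : (Fin n → ℝ) → ℝ≥0∞) (Q : Cube n) : ℝ≥0∞ := ∫⁻ x in Q.toSet, w x

/-- The average `⟨|f|⟩_{r,Q} = (|Q|⁻¹ ∫_Q |f| ^ r) ^ (1/r)`. -/
def avg (r : ℝ) (Q : Cube n) (f : (Fin n → ℝ) → ℝ) : ℝ≥0∞ :=
  (Q.vol⁻¹ * ∫⁻ x in Q.toSet, ‖f x‖ₑ ^ r) ^ (1 / r)

/-- The Hardy--Littlewood maximal function over cubes, for a function with values in `[0, ∞]`. -/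
def maximalFn (w : (Fin n → ℝ) → ℝ≥0∞) (x : Fin n → ℝ) : ℝ≥0∞ :=
  ⨆ (Q : Cube n) (_ : x ∈ Q.toSet), Q.vol⁻¹ * mass w Q

/-- The (Fujii--Wilson) constant `[w]_{A_∞} = sup_Q w(Q)⁻¹ ∫_Q M(w χ_Q)`, the supremum being taken
over all cubes. It is `∞` if `w` fails to be integrable over some cube. -/
def ainfty (w : (Fin n → ℝ) → ℝ≥0∞) : ℝ≥0∞ :=
  ⨆ Q : Cube n, if mass w Q = ∞ then ∞ else
    (∫⁻ x in Q.toSet, maximalFn (Q.toSet.indicator w) x) / mass w Q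

/-- The two-weight constant `sup_{Q ∈ S} |Q| ^ a * u(Q) ^ b * v(Q) ^ c` of a family `S` of cubes. -/
def twoWeightConst (a b c : ℝ) (S : Set (Cube n)) (u v : (Fin n → ℝ) → ℝ≥0∞) : ℝ≥0∞ :=
  ⨆ Q ∈ S, Q.vol ^ a * mass u Q ^ b * mass v Q ^ c

/-- The two-weight class `A^a_{b,c}(S)`. -/
def MemTwoWeight (a b c : ℝ) (S : Set (Cube n)) (u v : (Fin n → ℝ) → ℝ≥0∞) : Prop :=
  twoWeightConst a b c S u v < ∞

/-- The measure `w(x) dx`. -/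
def wmeasure (w : (Fin n → ℝ) → ℝ) : Measure (Fin n → ℝ) :=
  volume.withDensity fun x => ENNReal.ofReal (w x)

/-- The fractional sparse form `∑_{Q ∈ S} ⟨|f|⟩_{r,Q} ⟨|g|⟩_{t,Q} |Q| ^ (1 + α)`. -/
def sparseForm (r t α : ℝ) (S : Set (Cube n)) (f g : (Fin n → ℝ) → ℝ) : ℝ≥0∞ :=
  ∑' Q : S, avg r Q.1 f * avg t Q.1 g * Q.1.vol ^ (1 + α)

/-- The best constant `N ∈ [0, ∞]` such that, for all `f ∈ L^p(ω)` and `g ∈ L^{q'}(σ)`,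
`∑_{Q ∈ S} ⟨|f|⟩_{r,Q} ⟨|g|⟩_{s',Q} |Q| ^ (1 + α) ≤ N ‖f‖_{L^p(ω)} ‖g‖_{L^{q'}(σ)}`.
Here `q'` (which is `∞` for `q = 1`) and `s'` are the conjugate exponents. -/
def bestConst (r p q : ℝ) (s : ℝ≥0∞) (α : ℝ) (S : Set (Cube n)) (ω σ : (Fin n → ℝ) → ℝ) : ℝ≥0∞ :=
  sInf {K : ℝ≥0∞ | ∀ f g : (Fin n → ℝ) → ℝ,
    MemLp f (ENNReal.ofReal p) (wmeasure ω) →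
    MemLp g (ENNReal.conjExponent (ENNReal.ofReal q)) (wmeasure σ) →
    sparseForm r (ENNReal.conjExponent s).toReal α S f g ≤
      K * eLpNorm f (ENNReal.ofReal p) (wmeasure ω) *
        eLpNorm g (ENNReal.conjExponent (ENNReal.ofReal q)) (wmeasure σ)}

/-- The exponent `s' / (s' - q')`, read as `0` if `q' = ∞`. -/
def dualPower (s' q' : ℝ≥0∞) : ℝ :=
  if q' = ∞ then 0 else s'.toReal / (s'.toReal - q'.toReal)

/-- The `A_∞` factor of the upper bound, in terms of `U = [u]_{A_∞}` and `V = [v]_{A_∞}`;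
note that `1 - 1 / p = 1 / p'`, which is `0` for `p = 1`. -/
def ainftyFactor (p q α : ℝ) (U V : ℝ≥0∞) : ℝ≥0∞ :=
  if p = q ∧ 0 < α then
    U ^ (1 - (1 - 1 / p) ^ 2) * V ^ ((1 - 1 / p) ^ 2) + U ^ (1 / p ^ 2) * V ^ (1 - 1 / p ^ 2)
  else U ^ (1 / q) + V ^ (1 - 1 / p)

end SparseForm

end

noncomputable section

namespace SparseForm

open Classical

/-! ### Laminar families: increments, summation by parts, Doob's inequality -/

section

variable {X : Type*}

/-! Let `ρ`, `μ`, `ν` be the measures `dx`, `u dx`, `v dx`, and let `t = q'`.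

Lower bound: a single term of the form is tested with `f = u ^ (1 / r)` and `g = v ^ (1 / s')` on
one cube. Truncation keeps the norms finite, and the masses converge to `u(Q)` and `v(Q)`
(`le_of_hasTestSequence`).

Upper bound for `q > 1`: writing `|f| ^ r = h u` turns `⟨|f|⟩_{r,Q}` into `|Q| ^ (-1/r) u(Q) ^
(1/r)` times the power `1/r` of the `u`-average of `h`, and `‖f‖_{L^p(ω)}` into a norm of `h` with
respect to `u`; likewise for `g` (`IsWeight.exists_density`). Fix a finite subfamily and replace
each average by the largest one over the members containing `Q`. The resulting coefficients `m`,
`m'` grow as cubes shrink, and Doob's inequality (`energy_maxMean_le`) controls their maximal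
functions by the norms of `f` and `g`. What remains is to bound the sum of `m m' k w`, where `k =
ρ^a μ^b ν^c ≤ [u,v]` and `w = μ^(1/p) ν^(1/t)`.

The decisive point is that on a family where `k` is constant up to a factor 2, `w` satisfies a
packing condition whose constant does not involve the weights. There `w = k^δ g`, where `g` is a
product of positive powers of `ρ`, `μ`, `ν` because `a < 0`. For small `δ` its total degree is at
least one, since `a + b + c = α - (1/p - 1/q)` is nonpositive or `p < q`. Such a product packs
because `ρ` alone does: the nesting depth is exponentially integrable for `ρ`, and a factor decaying
in the depth makes `μ` and `ν` summable (`sum_rpow_three_le`).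

Summation by parts then puts an increment on one of `m`, `m'`. The factor with the increment is
summable without loss; only the other one uses a packing constant `[u]_{A_∞}` or `[v]_{A_∞}`, raised
to `1/q` or `1/p'` by Hölder (`sum_level_le`). The levels `k ≈ 2^(-j) [u,v]` add up geometrically
(`sum_le_add`).

When `p = q` and `α > 0` the degree would fall below one. Hölder with both packing constants gives
`U^(1/p) V^(1/p')`, the geometric mean of the two terms in the claim. When `q = 1` the averages of
`g` are at most `‖g‖_∞`, and one packing estimate for `u` suffices. -/

/-- A finite family of nonempty sets, any two of which are nested or disjoint. -/
structure Laminar (T : Finset (Set X)) : Prop where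
  nonempty : ∀ Q ∈ T, Q.Nonempty
  nested : ∀ P ∈ T, ∀ Q ∈ T, (P ∩ Q).Nonempty → P ⊆ Q ∨ Q ⊆ P

theorem Laminar.subset {T T' : Finset (Set X)} (hT : Laminar T) (h : T' ⊆ T) : Laminar T' :=
  ⟨fun Q hQ => hT.nonempty Q (h hQ), fun P hP Q hQ => hT.nested P (h hP) Q (h hQ)⟩

theorem Laminar.exists_least {T A : Finset (Set X)} (hT : Laminar T) (hA : A ⊆ T)
    (hne : A.Nonempty) {x : X} (hx : ∀ R ∈ A, x ∈ R) : ∃ P ∈ A, ∀ R ∈ A, P ⊆ R := by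
  obtain ⟨P, hP⟩ := A.exists_minimal hne
  refine ⟨P, hP.1, fun R hR => ?_⟩
  rcases hT.nested P (hA hP.1) R (hA hR) ⟨x, hx P hP.1, hx R hR⟩ with h | h
  · exact h
  · exact hP.2 hR h

/-- The largest value of `m` at the members of `T` that strictly contain `Q`. -/
def ancestorSup (T : Finset (Set X)) (m : Set X → ℝ≥0∞) (Q : Set X) : ℝ≥0∞ :=
  (T.filter (Q ⊂ ·)).sup m

/-- The increment of `m` at `Q` over the strict ancestors of `Q` in `T`. -/
def incr (T : Finset (Set X)) (m : Set X → ℝ≥0∞) (Q : Set X) : ℝ≥0∞ :=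
  m Q - ancestorSup T m Q

/-- `m` increases along the family as the sets shrink. -/
def MonoOn (T : Finset (Set X)) (m : Set X → ℝ≥0∞) : Prop :=
  ∀ P ∈ T, ∀ Q ∈ T, P ⊆ Q → m Q ≤ m P

theorem MonoOn.rpow {T : Finset (Set X)} {m : Set X → ℝ≥0∞} (hm : MonoOn T m) {t : ℝ}
    (ht : 0 ≤ t) : MonoOn T fun Q => m Q ^ t :=
  fun P hP Q hQ h => ENNReal.rpow_le_rpow (hm P hP Q hQ h) ht

theorem MonoOn.mul {T : Finset (Set X)} {m m' : Set X → ℝ≥0∞} (hm : MonoOn T m)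
    (hm' : MonoOn T m') : MonoOn T fun Q => m Q * m' Q :=
  fun P hP Q hQ h => mul_le_mul' (hm P hP Q hQ h) (hm' P hP Q hQ h)

theorem MonoOn.ancestorSup_le {T : Finset (Set X)} {m : Set X → ℝ≥0∞} (hm : MonoOn T m)
    {Q : Set X} (hQ : Q ∈ T) : ancestorSup T m Q ≤ m Q :=
  Finset.sup_le fun R hR => by
    rw [Finset.mem_filter] at hR
    exact hm Q hQ R hR.1 hR.2.subset

/-- Either `Q` has no strict ancestor, or it has a least one. -/
theorem Laminar.parent {T : Finset (Set X)} (hT : Laminar T) {Q : Set X} (hQ : Q ∈ T) :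
    (∀ R ∈ T, ¬ Q ⊂ R) ∨ ∃ P ∈ T, Q ⊂ P ∧ ∀ R ∈ T, Q ⊂ R → P ⊆ R := by
  by_cases h : (T.filter (Q ⊂ ·)).Nonempty
  · right
    obtain ⟨x, hx⟩ := hT.nonempty Q hQ
    obtain ⟨P, hP, hP'⟩ := hT.exists_least (Finset.filter_subset _ _) h (x := x)
      (fun R hR => (Finset.mem_filter.1 hR).2.subset hx)
    rw [Finset.mem_filter] at hP
    exact ⟨P, hP.1, hP.2, fun R hR hQR => hP' R (Finset.mem_filter.2 ⟨hR, hQR⟩)⟩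
  · left
    intro R hR hQR
    exact h ⟨R, Finset.mem_filter.2 ⟨hR, hQR⟩⟩

theorem ancestorSup_eq_zero {T : Finset (Set X)} {m : Set X → ℝ≥0∞} {Q : Set X}
    (h : ∀ R ∈ T, ¬ Q ⊂ R) : ancestorSup T m Q = 0 := by
  unfold ancestorSup
  rw [Finset.filter_false_of_mem h]
  rfl

theorem MonoOn.ancestorSup_eq {T : Finset (Set X)} {m : Set X → ℝ≥0∞} (hm : MonoOn T m)
    {P Q : Set X} (hP : P ∈ T) (hQP : Q ⊂ P) (h : ∀ R ∈ T, Q ⊂ R → P ⊆ R) :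
    ancestorSup T m Q = m P := by
  apply le_antisymm
  · refine Finset.sup_le fun R hR => ?_
    rw [Finset.mem_filter] at hR
    exact hm P hP R hR.1 (h R hR.1 hR.2)
  · exact Finset.le_sup (f := m) (Finset.mem_filter.2 ⟨hP, hQP⟩)

/-- The members containing `Q` form a chain, along which the increments telescope. The induction
passes from `Q` to its least strict ancestor. -/
theorem sum_incr {T : Finset (Set X)} (hT : Laminar T) {m : Set X → ℝ≥0∞} (hm : MonoOn T m)
    {Q : Set X} (hQ : Q ∈ T) : ∑ R ∈ T.filter (Q ⊆ ·), incr T m R = m Q := by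
  induction hk : (T.filter (Q ⊆ ·)).card using Nat.strong_induction_on generalizing Q with
  | _ k ih =>
  have hself : ∀ R, Q ⊆ R ↔ R = Q ∨ Q ⊂ R := fun R => by
    rw [subset_iff_ssubset_or_eq, or_comm, eq_comm]
  have hsplit : T.filter (Q ⊆ ·) = insert Q (T.filter (Q ⊂ ·)) := by
    ext R
    simp only [Finset.mem_filter, Finset.mem_insert, hself R]
    constructor
    · rintro ⟨h1, h2 | h2⟩
      · exact Or.inl h2
      · exact Or.inr ⟨h1, h2⟩
    · rintro (rfl | ⟨h1, h2⟩)
      · exact ⟨hQ, Or.inl rfl⟩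
      · exact ⟨h1, Or.inr h2⟩
  have hnot : Q ∉ T.filter (Q ⊂ ·) := by simp
  rcases hT.parent hQ with h | ⟨P, hP, hQP, h⟩
  · rw [hsplit, Finset.sum_insert hnot, Finset.filter_false_of_mem h, incr,
      ancestorSup_eq_zero h]
    simp
  · have hPQ : T.filter (Q ⊂ ·) = T.filter (P ⊆ ·) := by
      apply Finset.filter_congr
      intro R hR
      exact ⟨h R hR, fun h' => hQP.trans_subset h'⟩
    have := ih _ (by
      rw [← hk, hsplit, Finset.card_insert_of_notMem hnot, hPQ]; exact Nat.lt_succ_self _) hP rfl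
    rw [hsplit, Finset.sum_insert hnot, hPQ, this, incr, hm.ancestorSup_eq hP hQP h]
    exact tsub_add_cancel_of_le (hm Q hQ P hP hQP.subset)

/-- Discrete Leibniz rule. It decides which of the two coefficients carries the increment after
summation by parts. -/
theorem incr_mul_le {T : Finset (Set X)} (hT : Laminar T) {m m' : Set X → ℝ≥0∞}
    (hm : MonoOn T m) (hm' : MonoOn T m') {Q : Set X} (hQ : Q ∈ T) :
    incr T (fun Q => m Q * m' Q) Q ≤ incr T m Q * m' Q + m Q * incr T m' Q := by
  rcases hT.parent hQ with h | ⟨P, hP, hQP, h⟩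
  · simp [incr, ancestorSup_eq_zero h]
  · rw [incr, incr, incr, hm.ancestorSup_eq hP hQP h, hm'.ancestorSup_eq hP hQP h,
      (hm.mul hm').ancestorSup_eq hP hQP h, tsub_le_iff_right]
    have h1 := hm Q hQ P hP hQP.subset
    have h2 := hm' Q hQ P hP hQP.subset
    calc m Q * m' Q = (m Q - m P + m P) * m' Q := by rw [tsub_add_cancel_of_le h1]
      _ = (m Q - m P) * m' Q + m P * (m' Q - m' P + m' P) := by
          rw [tsub_add_cancel_of_le h2, add_mul]
      _ ≤ (m Q - m P) * m' Q + (m Q * (m' Q - m' P) + m P * m' P) := by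
          rw [mul_add (m P)]; gcongr
      _ = _ := by rw [add_assoc]

/-- Summation by parts over a laminar family. -/
theorem sum_mul_eq {T : Finset (Set X)} (hT : Laminar T) {m : Set X → ℝ≥0∞} (hm : MonoOn T m)
    (c : Set X → ℝ≥0∞) :
    ∑ Q ∈ T, m Q * c Q = ∑ R ∈ T, incr T m R * ∑ Q ∈ T.filter (· ⊆ R), c Q := by
  calc ∑ Q ∈ T, m Q * c Q
      = ∑ Q ∈ T, ∑ R ∈ T, if Q ⊆ R then incr T m R * c Q else 0 := by
        refine Finset.sum_congr rfl fun Q hQ => ?_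
        rw [← sum_incr hT hm hQ, Finset.sum_mul, Finset.sum_filter]
    _ = ∑ R ∈ T, ∑ Q ∈ T, if Q ⊆ R then incr T m R * c Q else 0 := Finset.sum_comm
    _ = _ := by
        refine Finset.sum_congr rfl fun R _ => ?_
        rw [Finset.mul_sum, Finset.sum_filter]

/-- This is the form in which packing hypotheses are used: a packing bound for `c` allows `m` to be
replaced by its increments. -/
theorem sum_mul_le {T : Finset (Set X)} (hT : Laminar T) {m : Set X → ℝ≥0∞} (hm : MonoOn T m)
    {c d : Set X → ℝ≥0∞} {A : ℝ≥0∞} (h : ∀ R ∈ T, ∑ Q ∈ T.filter (· ⊆ R), c Q ≤ A * d R) :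
    ∑ Q ∈ T, m Q * c Q ≤ A * ∑ R ∈ T, incr T m R * d R := by
  rw [sum_mul_eq hT hm, Finset.mul_sum]
  refine Finset.sum_le_sum fun R hR => ?_
  calc _ ≤ incr T m R * (A * d R) := by gcongr; exact h R hR
    _ = _ := by ring

/-- The increments over the members containing a point add up to the largest value there. -/
theorem sum_incr_mem {T : Finset (Set X)} (hT : Laminar T) {m : Set X → ℝ≥0∞} (hm : MonoOn T m)
    (x : X) : ∑ R ∈ T.filter (x ∈ ·), incr T m R = (T.filter (x ∈ ·)).sup m := by
  by_cases hne : (T.filter (x ∈ ·)).Nonempty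
  · obtain ⟨P, hP, hP'⟩ := hT.exists_least (Finset.filter_subset _ _) hne (x := x)
      (fun R hR => (Finset.mem_filter.1 hR).2)
    have hPT := (Finset.mem_filter.1 hP).1
    have hxP := (Finset.mem_filter.1 hP).2
    have hPeq : T.filter (x ∈ ·) = T.filter (P ⊆ ·) := by
      ext R
      simp only [Finset.mem_filter]
      exact ⟨fun h => ⟨h.1, hP' R (Finset.mem_filter.2 h)⟩, fun h => ⟨h.1, h.2 hxP⟩⟩
    apply le_antisymm
    · rw [hPeq, sum_incr hT hm hPT, ← hPeq]
      exact Finset.le_sup (f := m) hP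
    · rw [hPeq, sum_incr hT hm hPT, ← hPeq]
      refine Finset.sup_le fun R hR => hm P hPT R (Finset.mem_filter.1 hR).1 (hP' R hR)
  · rw [Finset.not_nonempty_iff_eq_empty] at hne
    simp [hne]

theorem ancestorSup_rpow {T : Finset (Set X)} (hT : Laminar T) {m : Set X → ℝ≥0∞}
    (hm : MonoOn T m) {t : ℝ} (ht : 0 < t) {Q : Set X} (hQ : Q ∈ T) :
    ancestorSup T (fun R => m R ^ t) Q = ancestorSup T m Q ^ t := by
  rcases hT.parent hQ with h | ⟨P, hP, hQP, h⟩
  · simp [ancestorSup_eq_zero h, ht]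
  · rw [hm.ancestorSup_eq hP hQP h, (hm.rpow ht.le).ancestorSup_eq hP hQP h]

variable [MeasurableSpace X]

theorem sum_mul_lintegral_eq {T : Finset (Set X)} (hmeas : ∀ Q ∈ T, MeasurableSet Q)
    (μ : Measure X) (c : Set X → ℝ≥0∞) {h : X → ℝ≥0∞} (hh : AEMeasurable h μ) :
    ∑ R ∈ T, c R * ∫⁻ x in R, h x ∂μ = ∫⁻ x, h x * ∑ R ∈ T.filter (x ∈ ·), c R ∂μ := by
  calc ∑ R ∈ T, c R * ∫⁻ x in R, h x ∂μ
      = ∑ R ∈ T, ∫⁻ x, R.indicator (fun x => c R * h x) x ∂μ := by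
        refine Finset.sum_congr rfl fun R hR => ?_
        rw [lintegral_indicator (hmeas R hR), lintegral_const_mul'' _ hh.restrict]
    _ = ∫⁻ x, ∑ R ∈ T, R.indicator (fun x => c R * h x) x ∂μ := by
        rw [lintegral_finsetSum' _ fun R hR => (hh.const_mul _).indicator (hmeas R hR)]
    _ = _ := by
        refine lintegral_congr fun x => ?_
        rw [Finset.mul_sum, Finset.sum_filter]
        refine Finset.sum_congr rfl fun R _ => ?_
        simp only [Set.indicator]
        split_ifs <;> ring

/-- By Young's inequality, `y^(t-1) x ≤ ((t-1) y^t + x^t) / t`. The constant is the conjugate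
exponent of `t`, and it becomes Doob's constant. -/
theorem rpow_sub_rpow_le {t : ℝ} (ht : 1 < t) {x y : ℝ≥0∞} (hx : x ≠ ∞) (hyx : y ≤ x) :
    x ^ t - y ^ t ≤ ENNReal.ofReal (t / (t - 1)) * ((x ^ (t - 1) - y ^ (t - 1)) * x) := by
  have hy : y ≠ ∞ := ne_top_of_le_ne_top hx hyx
  have ht1 : 0 < t - 1 := by linarith
  obtain ⟨a, ha, rfl⟩ : ∃ a : ℝ, 0 ≤ a ∧ ENNReal.ofReal a = x :=
    ⟨x.toReal, ENNReal.toReal_nonneg, ENNReal.ofReal_toReal hx⟩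
  obtain ⟨b, hb, rfl⟩ : ∃ b : ℝ, 0 ≤ b ∧ ENNReal.ofReal b = y :=
    ⟨y.toReal, ENNReal.toReal_nonneg, ENNReal.ofReal_toReal hy⟩
  rw [ENNReal.ofReal_rpow_of_nonneg ha (by linarith), ENNReal.ofReal_rpow_of_nonneg hb (by linarith),
    ENNReal.ofReal_rpow_of_nonneg ha ht1.le, ENNReal.ofReal_rpow_of_nonneg hb ht1.le,
    ← ENNReal.ofReal_sub _ (by positivity), ← ENNReal.ofReal_sub _ (by positivity),
    ← ENNReal.ofReal_mul' ha, ← ENNReal.ofReal_mul (by positivity)]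
  apply ENNReal.ofReal_le_ofReal
  have hconj : (t / (t - 1)).HolderConjugate t := (Real.HolderConjugate.conjExponent ht).symm
  have young := Real.young_inequality_of_nonneg (a := b ^ (t - 1)) (b := a) (by positivity) ha hconj
  rw [← Real.rpow_mul hb, mul_div_cancel₀ _ ht1.ne'] at young
  have hat : a ^ t = a ^ (t - 1) * a := by
    rcases ha.eq_or_lt with rfl | ha
    · rw [Real.zero_rpow (by linarith)]; simp
    · rw [← Real.rpow_add_one ha.ne']; ring_nf
  rw [sub_mul, ← hat, div_mul_eq_mul_div, le_div_iff₀ ht1]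
  have h2 : b ^ t / (t / (t - 1)) + a ^ t / t = ((t - 1) * b ^ t + a ^ t) / t := by
    field_simp
  rw [h2, le_div_iff₀ (by linarith)] at young
  linarith

/-- The sum of the increments of `m`, weighted by the measure. -/
def energy (T : Finset (Set X)) (μ : Measure X) (m : Set X → ℝ≥0∞) : ℝ≥0∞ :=
  ∑ R ∈ T, incr T m R * μ R

/-- Layer-cake formula: at each point the increments add up to the maximal function of `m`. The
energy is therefore monotone in the family. -/
theorem energy_eq {T : Finset (Set X)} (hT : Laminar T) (hmeas : ∀ Q ∈ T, MeasurableSet Q)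
    (μ : Measure X) {m : Set X → ℝ≥0∞} (hm : MonoOn T m) :
    energy T μ m = ∫⁻ x, (T.filter (x ∈ ·)).sup m ∂μ := by
  have := sum_mul_lintegral_eq hmeas μ (incr T m) (h := fun _ => 1) aemeasurable_const
  simp only [sum_incr_mem hT hm, one_mul, lintegral_const, Measure.restrict_apply_univ] at this
  exact this

/-- The average of `h` over `Q`. -/
def mean (μ : Measure X) (h : X → ℝ≥0∞) (Q : Set X) : ℝ≥0∞ := (μ Q)⁻¹ * ∫⁻ x in Q, h x ∂μ

/-- The largest average of `h` over the members of `T` that contain `Q`. -/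
def maxMean (T : Finset (Set X)) (μ : Measure X) (h : X → ℝ≥0∞) (Q : Set X) : ℝ≥0∞ :=
  (T.filter (Q ⊆ ·)).sup (mean μ h)

theorem maxMean_mono (T : Finset (Set X)) (μ : Measure X) (h : X → ℝ≥0∞) :
    MonoOn T (maxMean T μ h) := by
  intro P _ Q _ hPQ
  refine Finset.sup_mono fun R hR => ?_
  rw [Finset.mem_filter] at hR ⊢
  exact ⟨hR.1, hPQ.trans hR.2⟩

theorem mean_le_maxMean {T : Finset (Set X)} (μ : Measure X) (h : X → ℝ≥0∞) {Q : Set X}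
    (hQ : Q ∈ T) : mean μ h Q ≤ maxMean T μ h Q :=
  Finset.le_sup (f := mean μ h) (Finset.mem_filter.2 ⟨hQ, subset_rfl⟩)

/-- Only sets at which the running maximum is attained by their own average can have a nonzero
increment. This lets Doob's inequality replace the maximum by an integral of `h`. -/
theorem maxMean_eq_or_le {T : Finset (Set X)} (μ : Measure X) (h : X → ℝ≥0∞) {Q : Set X}
    (hQ : Q ∈ T) : maxMean T μ h Q = mean μ h Q ∨
      maxMean T μ h Q ≤ ancestorSup T (maxMean T μ h) Q := by
  obtain ⟨R, hR, hR'⟩ := Finset.exists_mem_eq_sup (T.filter (Q ⊆ ·))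
    ⟨Q, Finset.mem_filter.2 ⟨hQ, subset_rfl⟩⟩ (mean μ h)
  rw [Finset.mem_filter] at hR
  rcases eq_or_ssubset_of_subset hR.2 with rfl | hQR
  · exact Or.inl hR'
  · right
    calc maxMean T μ h Q = mean μ h R := hR'
      _ ≤ maxMean T μ h R := mean_le_maxMean μ h hR.1
      _ ≤ _ := Finset.le_sup (f := maxMean T μ h) (Finset.mem_filter.2 ⟨hR.1, hQR⟩)

/-- Doob's maximal inequality for a finite laminar family. -/
theorem energy_maxMean_le {T : Finset (Set X)} (hT : Laminar T)
    (hmeas : ∀ Q ∈ T, MeasurableSet Q) {μ : Measure X} (hμ0 : ∀ Q ∈ T, μ Q ≠ 0)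
    (hμ : ∀ Q ∈ T, μ Q ≠ ∞) {h : X → ℝ≥0∞} (hh : AEMeasurable h μ) {t : ℝ} (ht : 1 < t) :
    energy T μ (fun Q => maxMean T μ h Q ^ t) ≤
      ENNReal.ofReal (t / (t - 1)) ^ t * ∫⁻ x, h x ^ t ∂μ := by
  have ht1 : 0 < t - 1 := by linarith
  have ht0 : 0 < t := by linarith
  set C := ENNReal.ofReal (t / (t - 1)) with hC
  have hC0 : C ≠ 0 := by rw [hC, Ne, ENNReal.ofReal_eq_zero, not_le]; positivity
  set m := maxMean T μ h with hmdef
  have hm : MonoOn T m := maxMean_mono T μ h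
  set I := ∫⁻ x, h x ^ t ∂μ with hI
  by_cases hItop : I = ∞
  · rw [hItop, ENNReal.mul_top]
    · exact le_top
    · exact (ENNReal.rpow_pos (pos_iff_ne_zero.2 hC0) ENNReal.ofReal_ne_top).ne'
  -- Since `h ≤ 1 + h^t`, all averages are finite. Hence so is `E`, which is needed for the
  -- absorption at the end.
  have hmean : ∀ Q ∈ T, mean μ h Q ≠ ∞ := by
    intro Q hQ
    refine ENNReal.mul_ne_top (ENNReal.inv_ne_top.2 (hμ0 Q hQ)) ?_
    refine ne_top_of_le_ne_top (b := μ Q + I) (ENNReal.add_ne_top.2 ⟨hμ Q hQ, hItop⟩) ?_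
    calc ∫⁻ x in Q, h x ∂μ ≤ ∫⁻ x in Q, (1 + h x ^ t) ∂μ := by
          refine lintegral_mono fun x => ?_
          rcases le_total (h x) 1 with h1 | h1
          · exact h1.trans le_self_add
          · refine le_trans ?_ le_add_self
            calc h x = h x ^ (1 : ℝ) := (ENNReal.rpow_one _).symm
              _ ≤ _ := ENNReal.rpow_le_rpow_of_exponent_le h1 ht.le
      _ = μ Q + ∫⁻ x in Q, h x ^ t ∂μ := by
          rw [lintegral_add_left measurable_const]; simp
      _ ≤ _ := by gcongr; exact setLIntegral_le_lintegral _ _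
  have hmtop : ∀ Q ∈ T, m Q ≠ ∞ := by
    intro Q hQ
    refine ((Finset.sup_lt_iff ENNReal.zero_lt_top).2 fun R hR => ?_).ne
    exact (hmean R (Finset.mem_filter.1 hR).1).lt_top
  set E := energy T μ (fun Q => m Q ^ t) with hE
  have hEtop : E ≠ ∞ := by
    refine ENNReal.sum_ne_top.2 fun R hR => ENNReal.mul_ne_top ?_ (hμ R hR)
    exact ne_top_of_le_ne_top (ENNReal.rpow_ne_top_of_nonneg ht0.le (hmtop R hR)) tsub_le_self
  set G : X → ℝ≥0∞ := fun x => ∑ R ∈ T.filter (x ∈ ·), incr T (fun Q => m Q ^ (t - 1)) R with hG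
  have hGmeas : Measurable G := by
    have : G = fun x => ∑ R ∈ T, R.indicator (fun _ => incr T (fun Q => m Q ^ (t - 1)) R) x := by
      funext x
      rw [hG]
      simp only [Finset.sum_filter, Set.indicator]
    rw [this]
    exact Finset.measurable_fun_sum _ fun R hR => measurable_const.indicator (hmeas R hR)
  have key : E ≤ C * ∫⁻ x, h x * G x ∂μ := by
    rw [hG, ← sum_mul_lintegral_eq hmeas μ _ hh, Finset.mul_sum]
    refine Finset.sum_le_sum fun R hR => ?_
    -- At a new maximum `m R * μ R` equals the integral of `h` over `R`; at all other sets the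
    -- increment of `m ^ t` vanishes.
    rcases maxMean_eq_or_le μ h hR with h1 | h1
    · have h2 : m R * μ R = ∫⁻ x in R, h x ∂μ := by
        rw [hmdef, h1, mean, mul_comm, ← mul_assoc, ENNReal.mul_inv_cancel (hμ0 R hR) (hμ R hR),
          one_mul]
      simp only [incr]
      rw [ancestorSup_rpow hT hm ht0 hR, ancestorSup_rpow hT hm ht1 hR, ← h2]
      calc _ ≤ C * ((m R ^ (t - 1) - ancestorSup T m R ^ (t - 1)) * m R) * μ R := by
            gcongr
            exact rpow_sub_rpow_le ht (hmtop R hR) (hm.ancestorSup_le hR)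
        _ = _ := by ring
    · simp only [incr]
      rw [ancestorSup_rpow hT hm ht0 hR,
        tsub_eq_zero_of_le (ENNReal.rpow_le_rpow h1 ht0.le)]
      simp
  have hGE : ∫⁻ x, G x ^ (t / (t - 1)) ∂μ ≤ E := by
    rw [hE, energy_eq hT hmeas μ (hm.rpow ht0.le)]
    refine lintegral_mono fun x => ?_
    simp only [hG]
    rw [sum_incr_mem hT (hm.rpow ht1.le)]
    by_cases hne : (T.filter (x ∈ ·)).Nonempty
    · obtain ⟨R, hR, hR'⟩ := Finset.exists_mem_eq_sup _ hne (fun Q => m Q ^ (t - 1))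
      rw [hR', ← ENNReal.rpow_mul, mul_div_cancel₀ _ ht1.ne']
      exact Finset.le_sup (f := fun Q => m Q ^ t) hR
    · rw [Finset.not_nonempty_iff_eq_empty] at hne
      rw [hne]
      simp [ht0, ht1]
  have hconj : t.HolderConjugate (t / (t - 1)) := Real.HolderConjugate.conjExponent ht
  have h3 : E ≤ C * (I ^ (1 / t) * E ^ (1 / (t / (t - 1)))) := by
    refine key.trans ?_
    gcongr
    refine (ENNReal.lintegral_mul_le_Lp_mul_Lq μ hconj hh hGmeas.aemeasurable).trans ?_
    gcongr
  by_cases hE0 : E = 0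
  · rw [hE0]; exact zero_le
  -- Cancel `E` to the power `1 / t'`, which is legitimate because `0 < E < ∞`.
  have h4 : E ^ (1 / t) ≤ C * I ^ (1 / t) := by
    have hsplit : E = E ^ (1 / t) * E ^ (1 / (t / (t - 1))) := by
      rw [← ENNReal.rpow_add _ _ hE0 hEtop, one_div, one_div, hconj.inv_add_inv_eq_one,
        ENNReal.rpow_one]
    have hpos : E ^ (1 / (t / (t - 1))) ≠ 0 :=
      (ENNReal.rpow_pos (pos_iff_ne_zero.2 hE0) hEtop).ne'
    have hfin : E ^ (1 / (t / (t - 1))) ≠ ∞ :=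
      ENNReal.rpow_ne_top_of_nonneg (by positivity) hEtop
    rw [← ENNReal.mul_le_mul_iff_left hpos hfin, ← hsplit, mul_assoc]
    exact h3
  calc E = (E ^ (1 / t)) ^ t := by
        rw [← ENNReal.rpow_mul, one_div_mul_cancel ht0.ne', ENNReal.rpow_one]
    _ ≤ (C * I ^ (1 / t)) ^ t := ENNReal.rpow_le_rpow h4 ht0.le
    _ = C ^ t * I := by
        rw [ENNReal.mul_rpow_of_nonneg _ _ ht0.le, ← ENNReal.rpow_mul,
          one_div_mul_cancel ht0.ne', ENNReal.rpow_one]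

end

/-! ### Nesting depth, and packing of products of powers of three measures -/

section

variable {X : Type*}

/-- Superadditivity of `x ↦ x^p`. It is why the factor carrying the increment costs no packing
constant. -/
theorem incr_rpow_le {T : Finset (Set X)} (hT : Laminar T) {m : Set X → ℝ≥0∞} (hm : MonoOn T m)
    {p : ℝ} (hp : 1 ≤ p) {Q : Set X} (hQ : Q ∈ T) :
    incr T m Q ^ p ≤ incr T (fun R => m R ^ p) Q := by
  have hp0 : 0 < p := by linarith
  simp only [incr]
  rw [ancestorSup_rpow hT hm hp0 hQ]
  have hle := hm.ancestorSup_le hQ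
  by_cases htop : ancestorSup T m Q = ∞
  · rw [htop, top_le_iff] at hle
    simp [htop, hp0]
  · refine ENNReal.le_sub_of_add_le_right (ENNReal.rpow_ne_top_of_nonneg hp0.le htop) ?_
    refine (ENNReal.add_rpow_le_rpow_add _ _ hp).trans ?_
    rw [tsub_add_cancel_of_le hle]

/-- The number of members of `T` that contain `Q`. -/
def depth (T : Finset (Set X)) (Q : Set X) : ℕ := (T.filter (Q ⊆ ·)).card

theorem depth_mono (T : Finset (Set X)) {P Q : Set X} (h : P ⊆ Q) : depth T Q ≤ depth T P := by
  refine Finset.card_le_card fun R hR => ?_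
  rw [Finset.mem_filter] at hR ⊢
  exact ⟨hR.1, h.trans hR.2⟩

theorem depth_eq_of_parent {T : Finset (Set X)} {P Q : Set X} (hQ : Q ∈ T)
    (hQP : Q ⊂ P) (h : ∀ R ∈ T, Q ⊂ R → P ⊆ R) : depth T Q = depth T P + 1 := by
  have : T.filter (Q ⊆ ·) = insert Q (T.filter (P ⊆ ·)) := by
    ext R
    simp only [Finset.mem_filter, Finset.mem_insert]
    constructor
    · rintro ⟨h1, h2⟩
      rcases eq_or_ssubset_of_subset h2 with h3 | h3
      · exact Or.inl h3.symm
      · exact Or.inr ⟨h1, h R h1 h3⟩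
    · rintro (rfl | ⟨h1, h2⟩)
      · exact ⟨hQ, subset_rfl⟩
      · exact ⟨h1, hQP.subset.trans h2⟩
  rw [depth, this, Finset.card_insert_of_notMem, depth]
  simp only [Finset.mem_filter, not_and]
  exact fun _ h' => hQP.not_subset h'

theorem depth_eq_one {T : Finset (Set X)} {Q : Set X} (hQ : Q ∈ T) (h : ∀ R ∈ T, ¬ Q ⊂ R) :
    depth T Q = 1 := by
  have : T.filter (Q ⊆ ·) = {Q} := by
    ext R
    simp only [Finset.mem_filter, Finset.mem_singleton]
    constructor
    · rintro ⟨h1, h2⟩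
      rcases eq_or_ssubset_of_subset h2 with h3 | h3
      · exact h3.symm
      · exact (h R h1 h3).elim
    · rintro rfl
      exact ⟨hQ, subset_rfl⟩
  rw [depth, this, Finset.card_singleton]

theorem ennreal_sum_rpow_mul_rpow_le {ι : Type*} (s : Finset ι) (f g : ι → ℝ≥0∞) {θ : ℝ}
    (h0 : 0 < θ) (h1 : θ < 1) :
    ∑ i ∈ s, f i ^ θ * g i ^ (1 - θ) ≤ (∑ i ∈ s, f i) ^ θ * (∑ i ∈ s, g i) ^ (1 - θ) := by
  have hθ : 0 < 1 - θ := by linarith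
  have hconj : (1 / θ).HolderConjugate (1 / (1 - θ)) := by
    rw [Real.holderConjugate_iff]
    refine ⟨by rw [lt_div_iff₀ h0]; linarith, by simp⟩
  have := ENNReal.inner_le_Lp_mul_Lq s (fun i => f i ^ θ) (fun i => g i ^ (1 - θ)) hconj
  simpa only [← ENNReal.rpow_mul, mul_one_div_cancel h0.ne', mul_one_div_cancel hθ.ne',
    ENNReal.rpow_one, one_div_one_div] using this

variable [MeasurableSpace X]

/-- The Carleson packing condition for the family `T` and the measure `μ`. -/
def Carleson (T : Finset (Set X)) (μ : Measure X) (A : ℝ≥0∞) : Prop :=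
  ∀ R ∈ T, ∑ Q ∈ T.filter (· ⊆ R), μ Q ≤ A * μ R

theorem Carleson.subset {T T' : Finset (Set X)} {μ : Measure X} {A : ℝ≥0∞} (h : Carleson T μ A)
    (hT : T' ⊆ T) : Carleson T' μ A :=
  fun R hR => (Finset.sum_le_sum_of_subset (Finset.filter_subset_filter _ hT)).trans (h R (hT hR))

/-- Under a packing condition, the depth is exponentially integrable. -/
theorem sum_pow_depth_le {T : Finset (Set X)} (hT : Laminar T) {μ : Measure X}
    {A b : ℝ} (hA : 1 ≤ A) (hb : b = 2 * A / (2 * A - 1))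
    (hC : Carleson T μ (ENNReal.ofReal A)) {R : Set X} (hR : R ∈ T) (hroot : ∀ Q ∈ T, Q ⊆ R)
    (hfin : ∀ Q ∈ T, μ Q ≠ ∞) :
    ∑ Q ∈ T, μ Q * ENNReal.ofReal b ^ depth T Q ≤ ENNReal.ofReal (4 * A) * μ R := by
  have h2A : 0 < 2 * A - 1 := by linarith
  have hb1 : 1 < b := by rw [hb, lt_div_iff₀ h2A]; linarith
  have hb0 : 0 < b := by linarith
  have hb2 : b ≤ 2 := by rw [hb, div_le_iff₀ h2A]; linarith
  set B := ENNReal.ofReal b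
  have hB1 : 1 ≤ B := by rw [← ENNReal.ofReal_one]; exact ENNReal.ofReal_le_ofReal hb1.le
  have hm : MonoOn T fun Q => B ^ depth T Q :=
    fun P _ Q _ h => pow_le_pow_right₀ hB1 (depth_mono T h)
  set S := ∑ Q ∈ T, μ Q * B ^ depth T Q with hS
  have hStop : S ≠ ∞ := ENNReal.sum_ne_top.2 fun Q hQ =>
    ENNReal.mul_ne_top (hfin Q hQ) (ENNReal.pow_ne_top ENNReal.ofReal_ne_top)
  -- The base `b` is chosen so that `1 - 1 / b = 1 / (2 * A)`. After multiplication by the packing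
  -- constant `A`, the increments give back half of `S`. The root has no ancestor, so its increment
  -- is `b ≤ 2` itself.
  have hincr : ∀ Q ∈ T, incr T (fun Q => B ^ depth T Q) Q ≤
      ENNReal.ofReal (1 / (2 * A)) * B ^ depth T Q + if Q = R then 2 else 0 := by
    intro Q hQ
    rcases hT.parent hQ with h | ⟨P, hP, hQP, h⟩
    · have hQR : Q = R := by
        by_contra hne
        exact h R hR ((hroot Q hQ).ssubset_of_ne hne)
      rw [incr, ancestorSup_eq_zero h, depth_eq_one hQ h, if_pos hQR, tsub_zero, pow_one]
      refine le_trans ?_ le_add_self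
      rw [← ENNReal.ofReal_ofNat]
      exact ENNReal.ofReal_le_ofReal hb2
    · refine le_trans ?_ le_self_add
      rw [incr, hm.ancestorSup_eq hP hQP h, depth_eq_of_parent hQ hQP h, tsub_le_iff_right,
        ← ENNReal.ofReal_pow hb0.le, ← ENNReal.ofReal_pow hb0.le,
        ← ENNReal.ofReal_mul (by positivity), ← ENNReal.ofReal_add (by positivity) (by positivity)]
      apply ENNReal.ofReal_le_ofReal
      have : b = 1 / (2 * A) * b + 1 := by rw [hb]; field_simp; ring
      calc b ^ (depth T P + 1) = b ^ depth T P * b := pow_succ _ _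
        _ = b ^ depth T P * (1 / (2 * A) * b + 1) := by rw [← this]
        _ ≤ _ := le_of_eq (by ring)
  have key : S ≤ ENNReal.ofReal (1 / 2) * S + ENNReal.ofReal (2 * A) * μ R := by
    calc S = ∑ Q ∈ T, B ^ depth T Q * μ Q := Finset.sum_congr rfl fun _ _ => mul_comm _ _
      _ ≤ ENNReal.ofReal A * ∑ Q ∈ T, incr T (fun Q => B ^ depth T Q) Q * μ Q :=
          sum_mul_le hT hm hC
      _ ≤ ENNReal.ofReal A * ∑ Q ∈ T,
          (ENNReal.ofReal (1 / (2 * A)) * (μ Q * B ^ depth T Q) + if Q = R then 2 * μ Q else 0) := by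
          gcongr with Q hQ
          refine (mul_le_mul_left (hincr Q hQ) _).trans_eq ?_
          split_ifs <;> ring
      _ = ENNReal.ofReal A * (ENNReal.ofReal (1 / (2 * A)) * S + 2 * μ R) := by
          rw [Finset.sum_add_distrib, ← Finset.mul_sum, Finset.sum_ite_eq' T R, if_pos hR]
      _ = _ := by
          rw [mul_add, ← mul_assoc, ← mul_assoc, ← ENNReal.ofReal_mul (by linarith),
            ← ENNReal.ofReal_ofNat, ← ENNReal.ofReal_mul (by linarith)]
          congr 3
          · field_simp
          · ring_nf
  have hhalf : S = ENNReal.ofReal (1 / 2) * S + ENNReal.ofReal (1 / 2) * S := by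
    rw [← add_mul, ← ENNReal.ofReal_add (by norm_num) (by norm_num)]; norm_num
  -- Half of `S` is absorbed; `S` is finite because the family and its measures are.
  have key2 : ENNReal.ofReal (1 / 2) * S ≤ ENNReal.ofReal (2 * A) * μ R := by
    have hne : ENNReal.ofReal (1 / 2) * S ≠ ∞ := ENNReal.mul_ne_top ENNReal.ofReal_ne_top hStop
    rw [← ENNReal.add_le_add_iff_left hne, ← hhalf]
    exact key
  calc S = ENNReal.ofReal 2 * (ENNReal.ofReal (1 / 2) * S) := by
        rw [← mul_assoc, ← ENNReal.ofReal_mul (by norm_num)]; norm_num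
    _ ≤ ENNReal.ofReal 2 * (ENNReal.ofReal (2 * A) * μ R) := by gcongr
    _ = _ := by rw [← mul_assoc, ← ENNReal.ofReal_mul (by norm_num)]; ring_nf

/-- A geometric weight in the depth makes any measure summable over the family. -/
theorem sum_geometric_depth_le {T : Finset (Set X)} (hT : Laminar T)
    (hmeas : ∀ Q ∈ T, MeasurableSet Q) (μ : Measure X) {γ : ℝ≥0∞} (hγ : γ < 1)
    {R : Set X} (hR : R ∈ T) (hroot : ∀ Q ∈ T, Q ⊆ R) :
    ∑ Q ∈ T, μ Q * γ ^ depth T Q ≤ (1 - γ)⁻¹ * μ R := by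
  -- A bounded function of the depth whose increments dominate `γ ^ depth`. Its maximal function is
  -- at most the geometric series and lives on `R`, so no packing of `μ` is needed.
  set m : Set X → ℝ≥0∞ := fun Q => ∑ i ∈ Finset.range (depth T Q), γ ^ i with hmdef
  have hm : MonoOn T m := fun P _ Q _ h =>
    Finset.sum_le_sum_of_subset (Finset.range_mono (depth_mono T h))
  have hγtop : γ ≠ ∞ := (hγ.trans ENNReal.one_lt_top).ne
  have hle : ∀ Q, m Q ≤ (1 - γ)⁻¹ := fun Q => by
    rw [← ENNReal.tsum_geometric]
    exact ENNReal.sum_le_tsum _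
  have hincr : ∀ Q ∈ T, γ ^ depth T Q ≤ incr T m Q := by
    intro Q hQ
    rcases hT.parent hQ with h | ⟨P, hP, hQP, h⟩
    · rw [incr, ancestorSup_eq_zero h, tsub_zero, hmdef]
      simp only [depth_eq_one hQ h, Finset.range_one, Finset.sum_singleton, pow_zero, pow_one]
      exact hγ.le
    · rw [incr, hm.ancestorSup_eq hP hQP h]
      simp only [hmdef, depth_eq_of_parent hQ hQP h, Finset.sum_range_succ]
      rw [ENNReal.add_sub_cancel_left]
      · exact pow_le_pow_right_of_le_one' hγ.le (Nat.le_succ _)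
      · exact ENNReal.sum_ne_top.2 fun i _ => ENNReal.pow_ne_top hγtop
  calc ∑ Q ∈ T, μ Q * γ ^ depth T Q ≤ energy T μ m := by
        refine Finset.sum_le_sum fun Q hQ => ?_
        rw [mul_comm]
        gcongr
        exact hincr Q hQ
    _ = ∫⁻ x, (T.filter (x ∈ ·)).sup m ∂μ := energy_eq hT hmeas μ hm
    _ ≤ ∫⁻ x, R.indicator (fun _ => (1 - γ)⁻¹) x ∂μ := by
        refine lintegral_mono fun x => Finset.sup_le fun Q hQ => ?_
        rw [Finset.mem_filter] at hQ
        rw [Set.indicator_of_mem (hroot Q hQ.1 hQ.2)]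
        exact hle Q
    _ = _ := by rw [lintegral_indicator (hmeas R hR), setLIntegral_const]

/-- The packing property of products of powers of three measures, of total degree one. -/
theorem sum_rpow_three_le_of_root {A x y z : ℝ} (hA : 1 ≤ A) (hx : 0 < x) (hy : 0 < y)
    (hz : 0 < z) (hxyz : x + y + z = 1) :
    ∃ C : ℝ≥0, ∀ (T : Finset (Set X)) (ρ μ ν : Measure X) (R : Set X), Laminar T →
      (∀ Q ∈ T, MeasurableSet Q) → (∀ Q ∈ T, ρ Q ≠ ∞) →
      Carleson T ρ (ENNReal.ofReal A) → R ∈ T → (∀ Q ∈ T, Q ⊆ R) →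
      ∑ Q ∈ T, ρ Q ^ x * (μ Q ^ y * ν Q ^ z) ≤ C * (ρ R ^ x * (μ R ^ y * ν R ^ z)) := by
  set b := 2 * A / (2 * A - 1) with hb
  have h2A : 0 < 2 * A - 1 := by linarith
  have hb1 : 1 < b := by rw [hb, lt_div_iff₀ h2A]; linarith
  have hb0 : 0 < b := by linarith
  -- This choice makes `b ^ x * g ^ (1 - x) = 1`. A growing power of the depth can be given to `ρ`
  -- and a decaying one to `μ` and `ν` before applying Hölder with exponents `x`, `y`, `z`.
  set g : ℝ := b ^ (-(x / (1 - x))) with hg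
  have h1x : 0 < 1 - x := by linarith
  have hg0 : 0 < g := Real.rpow_pos_of_pos hb0 _
  have hg1 : g < 1 := Real.rpow_lt_one_of_one_lt_of_neg hb1 (by
    rw [neg_lt_zero]; positivity)
  set γ := ENNReal.ofReal g
  have hγ1 : γ < 1 := by rw [← ENNReal.ofReal_one]; exact (ENNReal.ofReal_lt_ofReal_iff one_pos).2 hg1
  set D := (1 - γ)⁻¹
  have hD : D ≠ ∞ := ENNReal.inv_ne_top.2 (tsub_pos_of_lt hγ1).ne'
  set C := ENNReal.ofReal (4 * A) ^ x * D ^ (1 - x) with hCdef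
  have hC : C ≠ ∞ := ENNReal.mul_ne_top
    (ENNReal.rpow_ne_top_of_nonneg hx.le ENNReal.ofReal_ne_top)
    (ENNReal.rpow_ne_top_of_nonneg h1x.le hD)
  refine ⟨C.toNNReal, fun T ρ μ ν R hT hmeas hρ hCar hR hroot => ?_⟩
  rw [ENNReal.coe_toNNReal hC]
  have hθ0 : 0 < y / (1 - x) := by positivity
  have hθ1 : y / (1 - x) < 1 := by rw [div_lt_one h1x]; linarith
  have hθ : 1 - y / (1 - x) = z / (1 - x) := by
    rw [eq_div_iff h1x.ne', sub_mul, div_mul_cancel₀ _ h1x.ne']; linarith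
  have hone : ∀ k : ℕ, (ENNReal.ofReal b ^ k) ^ x * (γ ^ k) ^ (1 - x) = 1 := by
    intro k
    rw [← ENNReal.ofReal_pow hb0.le, ← ENNReal.ofReal_pow hg0.le,
      ENNReal.ofReal_rpow_of_pos (by positivity), ENNReal.ofReal_rpow_of_pos (by positivity),
      ← ENNReal.ofReal_mul (by positivity), hg, ← Real.rpow_natCast, ← Real.rpow_natCast,
      ← Real.rpow_mul hb0.le, ← Real.rpow_mul hb0.le, ← Real.rpow_mul hb0.le,
      ← Real.rpow_add hb0]
    have : (k : ℝ) * x + -(x / (1 - x)) * k * (1 - x) = 0 := by field_simp; ring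
    rw [this, Real.rpow_zero, ENNReal.ofReal_one]
  calc ∑ Q ∈ T, ρ Q ^ x * (μ Q ^ y * ν Q ^ z)
      = ∑ Q ∈ T, (ρ Q * ENNReal.ofReal b ^ depth T Q) ^ x *
          ((μ Q * γ ^ depth T Q) ^ (y / (1 - x)) *
            (ν Q * γ ^ depth T Q) ^ (1 - y / (1 - x))) ^ (1 - x) := by
        refine Finset.sum_congr rfl fun Q _ => ?_
        have e : (μ Q * γ ^ depth T Q) ^ (y / (1 - x)) *
            (ν Q * γ ^ depth T Q) ^ (1 - y / (1 - x)) =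
            (μ Q ^ (y / (1 - x)) * ν Q ^ (z / (1 - x))) * γ ^ depth T Q := by
          rw [ENNReal.mul_rpow_of_nonneg _ _ hθ0.le, hθ,
            ENNReal.mul_rpow_of_nonneg _ _ (by positivity : 0 ≤ z / (1 - x))]
          have : γ ^ depth T Q = (γ ^ depth T Q) ^ (y / (1 - x)) * (γ ^ depth T Q) ^ (z / (1 - x)) := by
            rw [← ENNReal.rpow_add_of_nonneg _ _ (by positivity) (by positivity), ← hθ,
              add_sub_cancel, ENNReal.rpow_one]
          conv_rhs => rw [this]
          ring
        rw [e, ENNReal.mul_rpow_of_nonneg _ _ hx.le, ENNReal.mul_rpow_of_nonneg _ _ h1x.le,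
          ENNReal.mul_rpow_of_nonneg _ _ h1x.le, ← ENNReal.rpow_mul, ← ENNReal.rpow_mul,
          div_mul_cancel₀ _ h1x.ne', div_mul_cancel₀ _ h1x.ne']
        calc _ = ρ Q ^ x * (μ Q ^ y * ν Q ^ z) * 1 := (mul_one _).symm
          _ = _ := by rw [← hone (depth T Q)]; ring
    _ ≤ (∑ Q ∈ T, ρ Q * ENNReal.ofReal b ^ depth T Q) ^ x *
          (∑ Q ∈ T, (μ Q * γ ^ depth T Q) ^ (y / (1 - x)) *
            (ν Q * γ ^ depth T Q) ^ (1 - y / (1 - x))) ^ (1 - x) :=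
        ennreal_sum_rpow_mul_rpow_le T _ _ hx (by linarith)
    _ ≤ (ENNReal.ofReal (4 * A) * ρ R) ^ x *
          ((D * μ R) ^ (y / (1 - x)) * (D * ν R) ^ (1 - y / (1 - x))) ^ (1 - x) := by
        gcongr
        · exact sum_pow_depth_le hT hA hb hCar hR hroot hρ
        · refine (ennreal_sum_rpow_mul_rpow_le T _ _ hθ0 hθ1).trans ?_
          gcongr
          · exact sum_geometric_depth_le hT hmeas μ hγ1 hR hroot
          · exact sum_geometric_depth_le hT hmeas ν hγ1 hR hroot
    _ = C * (ρ R ^ x * (μ R ^ y * ν R ^ z)) := by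
        have e : (D * μ R) ^ (y / (1 - x)) * (D * ν R) ^ (1 - y / (1 - x)) =
            (μ R ^ (y / (1 - x)) * ν R ^ (z / (1 - x))) * D := by
          rw [ENNReal.mul_rpow_of_nonneg _ _ hθ0.le, hθ,
            ENNReal.mul_rpow_of_nonneg _ _ (by positivity : 0 ≤ z / (1 - x))]
          have : D = D ^ (y / (1 - x)) * D ^ (z / (1 - x)) := by
            rw [← ENNReal.rpow_add_of_nonneg _ _ (by positivity) (by positivity), ← hθ,
              add_sub_cancel, ENNReal.rpow_one]
          conv_rhs => rw [this]
          ring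
        rw [e, ENNReal.mul_rpow_of_nonneg _ _ hx.le, ENNReal.mul_rpow_of_nonneg _ _ h1x.le,
          ENNReal.mul_rpow_of_nonneg _ _ h1x.le, ← ENNReal.rpow_mul, ← ENNReal.rpow_mul,
          div_mul_cancel₀ _ h1x.ne', div_mul_cancel₀ _ h1x.ne', hCdef]
        ring

/-- The packing property of products of powers of three measures, of total degree at least one. -/
theorem sum_rpow_three_le {A x y z : ℝ} (hA : 1 ≤ A) (hx : 0 < x) (hy : 0 < y)
    (hz : 0 < z) (hxyz : 1 ≤ x + y + z) :
    ∃ C : ℝ≥0, ∀ (T : Finset (Set X)) (ρ μ ν : Measure X), Laminar T →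
      (∀ Q ∈ T, MeasurableSet Q) → (∀ Q ∈ T, ρ Q ≠ ∞) →
      Carleson T ρ (ENNReal.ofReal A) → ∀ R ∈ T,
      ∑ Q ∈ T.filter (· ⊆ R), ρ Q ^ x * (μ Q ^ y * ν Q ^ z) ≤
        C * (ρ R ^ x * (μ R ^ y * ν R ^ z)) := by
  set M := x + y + z with hM
  have hM0 : 0 < M := by linarith
  obtain ⟨C, hC⟩ := sum_rpow_three_le_of_root (X := X) (x := x / M) (y := y / M) (z := z / M) hA
    (by positivity) (by positivity) (by positivity) (by rw [← add_div, ← add_div, div_self hM0.ne'])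
  refine ⟨C, fun T ρ μ ν hT hmeas hρ hCar R hR => ?_⟩
  set w : Set X → ℝ≥0∞ := fun Q => ρ Q ^ (x / M) * (μ Q ^ (y / M) * ν Q ^ (z / M)) with hw
  -- Reduction to degree one: the surplus `w Q ^ (M - 1)` is at most `w R ^ (M - 1)` by monotonicity
  -- of measures, which uses `M ≥ 1`.
  have hwM : ∀ Q, ρ Q ^ x * (μ Q ^ y * ν Q ^ z) = w Q ^ (M - 1) * w Q := by
    intro Q
    have h1 : w Q ^ (M - 1) * w Q = w Q ^ M := by
      conv_rhs => rw [show M = (M - 1) + 1 by ring]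
      rw [ENNReal.rpow_add_of_nonneg _ _ (by linarith) zero_le_one, ENNReal.rpow_one]
    rw [h1, hw, ENNReal.mul_rpow_of_nonneg _ _ hM0.le, ENNReal.mul_rpow_of_nonneg _ _ hM0.le,
      ← ENNReal.rpow_mul, ← ENNReal.rpow_mul, ← ENNReal.rpow_mul, div_mul_cancel₀ _ hM0.ne',
      div_mul_cancel₀ _ hM0.ne', div_mul_cancel₀ _ hM0.ne']
  have hsub : T.filter (· ⊆ R) ⊆ T := Finset.filter_subset _ _
  have key := hC (T.filter (· ⊆ R)) ρ μ ν R (hT.subset hsub) (fun Q hQ => hmeas Q (hsub hQ))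
    (fun Q hQ => hρ Q (hsub hQ)) (hCar.subset hsub) (Finset.mem_filter.2 ⟨hR, subset_rfl⟩)
    (fun Q hQ => (Finset.mem_filter.1 hQ).2)
  calc ∑ Q ∈ T.filter (· ⊆ R), ρ Q ^ x * (μ Q ^ y * ν Q ^ z)
      = ∑ Q ∈ T.filter (· ⊆ R), w Q ^ (M - 1) * w Q := Finset.sum_congr rfl fun Q _ => hwM Q
    _ ≤ ∑ Q ∈ T.filter (· ⊆ R), w R ^ (M - 1) * w Q := by
        gcongr with Q hQ
        have h : Q ⊆ R := (Finset.mem_filter.1 hQ).2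
        simp only [hw]
        gcongr
    _ = w R ^ (M - 1) * ∑ Q ∈ T.filter (· ⊆ R), w Q := by rw [Finset.mul_sum]
    _ ≤ w R ^ (M - 1) * (C * w R) := by gcongr
    _ = _ := by rw [hwM]; ring

end

/-! ### Estimates for the model sum over a laminar family -/

section

variable {X : Type*}

variable [MeasurableSpace X]

theorem energy_subset {T T' : Finset (Set X)} (hT : Laminar T) (hmeas : ∀ Q ∈ T, MeasurableSet Q)
    (μ : Measure X) {m : Set X → ℝ≥0∞} (hm : MonoOn T m) (h : T' ⊆ T) :
    energy T' μ m ≤ energy T μ m := by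
  rw [energy_eq hT hmeas μ hm, energy_eq (hT.subset h) (fun Q hQ => hmeas Q (h hQ)) μ
    (fun P hP Q hQ => hm P (h hP) Q (h hQ))]
  exact lintegral_mono fun x => Finset.sup_mono (Finset.filter_subset_filter _ h)

theorem mul_le_energy {T : Finset (Set X)} (hT : Laminar T) (μ : Measure X)
    {m : Set X → ℝ≥0∞} (hm : MonoOn T m) {Q : Set X} (hQ : Q ∈ T) :
    m Q * μ Q ≤ energy T μ m := by
  rw [← sum_incr hT hm hQ, Finset.sum_mul]
  calc _ ≤ ∑ R ∈ T.filter (Q ⊆ ·), incr T m R * μ R := by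
        gcongr with R hR
        exact (Finset.mem_filter.1 hR).2
    _ ≤ _ := Finset.sum_le_sum_of_subset (Finset.filter_subset _ _)

theorem sum_mul_le_energy {T : Finset (Set X)} (hT : Laminar T) {μ : Measure X} {A : ℝ≥0∞}
    (hA : Carleson T μ A) {m : Set X → ℝ≥0∞} (hm : MonoOn T m) :
    ∑ Q ∈ T, m Q * μ Q ≤ A * energy T μ m :=
  sum_mul_le hT hm hA

theorem sum_incr_rpow_mul_le {T : Finset (Set X)} (hT : Laminar T) (μ : Measure X)
    {m : Set X → ℝ≥0∞} (hm : MonoOn T m) {p : ℝ} (hp : 1 ≤ p) :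
    ∑ Q ∈ T, (incr T m Q * μ Q ^ (1 / p)) ^ p ≤ energy T μ fun Q => m Q ^ p := by
  have hp0 : 0 < p := by linarith
  refine Finset.sum_le_sum fun Q hQ => ?_
  rw [ENNReal.mul_rpow_of_nonneg _ _ hp0.le, ← ENNReal.rpow_mul, one_div_mul_cancel hp0.ne',
    ENNReal.rpow_one]
  gcongr
  exact incr_rpow_le hT hm hp hQ

/-- Hölder with exponents `p` and `p'`, where `p' ≥ t`. Each `m Q ^ t * ν Q` is at most the energy,
so the `ℓ^{p'}` sum reduces to the sum of these terms, to which packing applies once. Hence `V` has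
exponent `1 / p'`; for `p = 1` the supremum is bounded directly and `V` is not used. -/
theorem sum_mul_rpow_le {T : Finset (Set X)} (hT : Laminar T) {ν : Measure X} {V : ℝ≥0∞}
    (hV : Carleson T ν V) {m : Set X → ℝ≥0∞} (hm : MonoOn T m) {p t : ℝ} (hp : 1 ≤ p)
    (ht : 0 < t) (hpt : 1 - 1 / p ≤ 1 / t) (a : Set X → ℝ≥0∞) :
    ∑ Q ∈ T, a Q * (m Q * ν Q ^ (1 / t)) ≤
      (∑ Q ∈ T, a Q ^ p) ^ (1 / p) * (V ^ (1 - 1 / p) *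
        (energy T ν fun Q => m Q ^ t) ^ (1 / t)) := by
  set Ψ := energy T ν fun Q => m Q ^ t with hΨ
  have hmt := hm.rpow ht.le
  have hy : ∀ Q, m Q * ν Q ^ (1 / t) = (m Q ^ t * ν Q) ^ (1 / t) := fun Q => by
    rw [ENNReal.mul_rpow_of_nonneg _ _ (by positivity), ← ENNReal.rpow_mul,
      mul_one_div_cancel ht.ne', ENNReal.rpow_one]
  rcases hp.eq_or_lt with rfl | hp1
  · simp only [ENNReal.rpow_one, div_one, sub_self, ENNReal.rpow_zero, one_mul]
    rw [Finset.sum_mul]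
    refine Finset.sum_le_sum fun Q hQ => ?_
    rw [hy]
    gcongr
    exact mul_le_energy hT ν hmt hQ
  · have hp0 : 0 < p := by linarith
    have hconj := Real.HolderConjugate.conjExponent hp1
    set p' := p.conjExponent with hp'
    have hp'0 : 0 < p' := hconj.symm.pos
    have hinv : 1 - 1 / p = 1 / p' := by
      rw [one_div, one_div, ← hconj.inv_add_inv_eq_one]; ring
    have hge : 0 ≤ p' / t - 1 := by
      rw [sub_nonneg, le_div_iff₀ ht, one_mul]
      rw [hinv] at hpt
      exact (one_div_le_one_div hp'0 ht).1 hpt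
    refine (ENNReal.inner_le_Lp_mul_Lq T a (fun Q => m Q * ν Q ^ (1 / t)) hconj).trans ?_
    gcongr
    rw [hinv]
    calc (∑ Q ∈ T, (m Q * ν Q ^ (1 / t)) ^ p') ^ (1 / p')
        ≤ (∑ Q ∈ T, Ψ ^ (p' / t - 1) * (m Q ^ t * ν Q)) ^ (1 / p') := by
          gcongr with Q hQ
          rw [hy, ← ENNReal.rpow_mul, one_div_mul_eq_div]
          calc (m Q ^ t * ν Q) ^ (p' / t)
              = (m Q ^ t * ν Q) ^ (p' / t - 1) * (m Q ^ t * ν Q) := by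
                conv_lhs => rw [show p' / t = (p' / t - 1) + 1 by ring]
                rw [ENNReal.rpow_add_of_nonneg _ _ hge zero_le_one, ENNReal.rpow_one]
            _ ≤ _ := by
                gcongr
                exact mul_le_energy hT ν hmt hQ
      _ ≤ (Ψ ^ (p' / t - 1) * (V * Ψ)) ^ (1 / p') := by
          rw [← Finset.mul_sum]
          gcongr
          exact sum_mul_le_energy hT hV hmt
      _ = (V * Ψ ^ (p' / t)) ^ (1 / p') := by
          congr 1
          conv_rhs => rw [show p' / t = (p' / t - 1) + 1 by ring]
          rw [ENNReal.rpow_add_of_nonneg _ _ hge zero_le_one, ENNReal.rpow_one]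
          ring
      _ = _ := by
          rw [ENNReal.mul_rpow_of_nonneg _ _ (by positivity), ← ENNReal.rpow_mul]
          congr 2
          field_simp

/-- Chooses how much of `ρ^a μ^b ν^c` to divide out of `μ^(1/p) ν^(1/t)`: the exponents of `μ` and
`ν` must stay positive and the total degree at least one. The degree condition is free when `a + b +
c ≤ 0`; otherwise the gap `1/p - 1/q > 0` leaves room. -/
theorem exists_pos_perturbation {a b c p q t : ℝ} (hp : 0 < p) (ht : 0 < t) (hpq : p ≤ q)
    (hb : 0 < b) (hc : 0 < c) (h : p < q ∨ a + b + c ≤ 0) :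
    ∃ δ : ℝ, 0 < δ ∧ 0 < 1 / p - δ * b ∧ 0 < 1 / t - δ * c ∧
      δ * (a + b + c) ≤ 1 / p - 1 / q := by
  have hle : 1 / q ≤ 1 / p := one_div_le_one_div_of_le hp hpq
  have main : ∀ ε : ℝ, 0 < ε → ∃ δ : ℝ, 0 < δ ∧ 0 < 1 / p - δ * b ∧ 0 < 1 / t - δ * c ∧ δ ≤ ε := by
    intro ε hε
    refine ⟨min ε (min (1 / p / (2 * b)) (1 / t / (2 * c))), by positivity, ?_, ?_, min_le_left _ _⟩
    · have h1 : min ε (min (1 / p / (2 * b)) (1 / t / (2 * c))) ≤ 1 / p / (2 * b) :=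
        (min_le_right _ _).trans (min_le_left _ _)
      have h2 : 1 / p / (2 * b) * b = 1 / p / 2 := by field_simp
      have h3 : 0 < 1 / p := by positivity
      nlinarith [mul_le_mul_of_nonneg_right h1 hb.le]
    · have h1 : min ε (min (1 / p / (2 * b)) (1 / t / (2 * c))) ≤ 1 / t / (2 * c) :=
        (min_le_right _ _).trans (min_le_right _ _)
      have h2 : 1 / t / (2 * c) * c = 1 / t / 2 := by field_simp
      have h3 : 0 < 1 / t := by positivity
      nlinarith [mul_le_mul_of_nonneg_right h1 hc.le]
  by_cases hs : a + b + c ≤ 0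
  · obtain ⟨δ, h1, h2, h3, -⟩ := main 1 one_pos
    exact ⟨δ, h1, h2, h3, (mul_nonpos_of_nonneg_of_nonpos h1.le hs).trans (by linarith)⟩
  · push Not at hs
    have hlt : 1 / q < 1 / p := one_div_lt_one_div_of_lt hp (h.resolve_right hs.not_ge)
    obtain ⟨δ, h1, h2, h3, h4⟩ := main ((1 / p - 1 / q) / (a + b + c)) (div_pos (by linarith) hs)
    exact ⟨δ, h1, h2, h3, (le_div_iff₀ hs).1 h4⟩

/-- The sum over a family on which `ρ ^ a * μ ^ b * ν ^ c` is essentially constant. -/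
theorem sum_level_le {a b c p q t A : ℝ} (hA : 1 ≤ A) (hp : 1 ≤ p) (hpq : p ≤ q)
    (hqt : q.HolderConjugate t) (ha : a < 0) (hb : 0 < b) (hc : 0 < c)
    (h : p < q ∨ a + b + c ≤ 0) :
    ∃ C : ℝ≥0, ∀ (T : Finset (Set X)) (ρ μ ν : Measure X) (U V κ : ℝ≥0∞) (m m' : Set X → ℝ≥0∞),
      Laminar T → (∀ Q ∈ T, MeasurableSet Q) → (∀ Q ∈ T, ρ Q ≠ ∞ ∧ μ Q ≠ ∞ ∧ ν Q ≠ ∞) →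
      (∀ Q ∈ T, ρ Q ≠ 0 ∧ μ Q ≠ 0 ∧ ν Q ≠ 0) →
      Carleson T ρ (ENNReal.ofReal A) → Carleson T μ U → Carleson T ν V →
      (∀ Q ∈ T, ρ Q ^ a * μ Q ^ b * ν Q ^ c ≤ κ ∧ κ ≤ 2 * (ρ Q ^ a * μ Q ^ b * ν Q ^ c)) →
      MonoOn T m → MonoOn T m' →
      ∑ Q ∈ T, m Q * m' Q * (μ Q ^ (1 / p) * ν Q ^ (1 / t)) ≤
        C * (U ^ (1 / q) + V ^ (1 - 1 / p)) *
          ((energy T μ fun Q => m Q ^ p) ^ (1 / p) * (energy T ν fun Q => m' Q ^ t) ^ (1 / t)) := by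
  have hp0 : 0 < p := by linarith
  have ht0 : 0 < t := hqt.symm.pos
  have hq0 : 0 < q := hqt.pos
  have ht1 : 1 < t := hqt.symm.lt
  have htq : 1 / t = 1 - 1 / q := by
    rw [one_div, one_div, ← hqt.inv_add_inv_eq_one]; ring
  have hqt' : 1 / q = 1 - 1 / t := by rw [htq]; ring
  have hle : 1 / q ≤ 1 / p := one_div_le_one_div_of_le hp0 hpq
  obtain ⟨δ, hδ, hy, hz, hδ'⟩ := exists_pos_perturbation hp0 ht0 hpq hb hc h
  -- The total degree is `1/p + 1/t - δ (a + b + c) = 1 + (1/p - 1/q) - δ (a + b + c) ≥ 1`. The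
  -- power of `ρ` is positive because `a < 0`.
  obtain ⟨C₀, hC₀⟩ := sum_rpow_three_le (X := X) (x := -a * δ) hA (mul_pos (neg_pos.2 ha) hδ) hy hz
    (by nlinarith)
  refine ⟨2 ^ δ * C₀, fun T ρ μ ν U V κ m m' hT hmeas hfin hpos hρ hU hV hκ hm hm' => ?_⟩
  set Φ := energy T μ fun Q => m Q ^ p
  set Ψ := energy T ν fun Q => m' Q ^ t
  set w : Set X → ℝ≥0∞ := fun Q => μ Q ^ (1 / p) * ν Q ^ (1 / t) with hw
  set k : Set X → ℝ≥0∞ := fun Q => ρ Q ^ a * μ Q ^ b * ν Q ^ c with hk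
  set g : Set X → ℝ≥0∞ := fun Q =>
    ρ Q ^ (-a * δ) * (μ Q ^ (1 / p - δ * b) * ν Q ^ (1 / t - δ * c)) with hg
  have hwk : ∀ Q ∈ T, w Q = k Q ^ δ * g Q := by
    intro Q hQ
    obtain ⟨f1, f2, f3⟩ := hfin Q hQ
    obtain ⟨e1, e2, e3⟩ := hpos Q hQ
    have h1 : ρ Q ^ (a * δ) * ρ Q ^ (-a * δ) = 1 := by
      rw [← ENNReal.rpow_add _ _ e1 f1]; simp
    have h2 : μ Q ^ (1 / p) = μ Q ^ (b * δ) * μ Q ^ (1 / p - δ * b) := by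
      rw [← ENNReal.rpow_add _ _ e2 f2]; ring_nf
    have h3 : ν Q ^ (1 / t) = ν Q ^ (c * δ) * ν Q ^ (1 / t - δ * c) := by
      rw [← ENNReal.rpow_add _ _ e3 f3]; ring_nf
    simp only [hw, hk, hg]
    rw [ENNReal.mul_rpow_of_nonneg _ _ hδ.le, ENNReal.mul_rpow_of_nonneg _ _ hδ.le,
      ← ENNReal.rpow_mul, ← ENNReal.rpow_mul, ← ENNReal.rpow_mul, h2, h3]
    calc _ = 1 * (μ Q ^ (b * δ) * μ Q ^ (1 / p - δ * b) *
          (ν Q ^ (c * δ) * ν Q ^ (1 / t - δ * c))) := (one_mul _).symm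
      _ = _ := by rw [← h1]; ring
  -- Since `k` is comparable to `κ` on the whole family, `w` inherits the packing of `g`, with a
  -- constant free of `U` and `V`.
  have hpack : ∀ R ∈ T, ∑ Q ∈ T.filter (· ⊆ R), w Q ≤ (2 ^ δ * C₀) * w R := by
    intro R hR
    calc ∑ Q ∈ T.filter (· ⊆ R), w Q ≤ ∑ Q ∈ T.filter (· ⊆ R), κ ^ δ * g Q := by
          refine Finset.sum_le_sum fun Q hQ => ?_
          have hQT := (Finset.mem_filter.1 hQ).1
          rw [hwk Q hQT]
          gcongr
          exact (hκ Q hQT).1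
      _ = κ ^ δ * ∑ Q ∈ T.filter (· ⊆ R), g Q := by rw [Finset.mul_sum]
      _ ≤ (2 * k R) ^ δ * (C₀ * g R) := by
          gcongr
          · exact (hκ R hR).2
          · exact hC₀ T ρ μ ν hT hmeas (fun Q hQ => (hfin Q hQ).1) hρ R hR
      _ = _ := by
          rw [hwk R hR, ENNReal.mul_rpow_of_nonneg _ _ hδ.le]; ring
  have hcoe : ((2 ^ δ * C₀ : ℝ≥0) : ℝ≥0∞) = 2 ^ δ * C₀ := by
    rw [ENNReal.coe_mul, ENNReal.coe_rpow_of_nonneg _ hδ.le, ENNReal.coe_ofNat]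
  rw [hcoe]
  -- The increment falls on `m`, so only `ν` is packed. In the symmetric estimate that follows only
  -- `μ` is packed, and its exponent is `1 - 1/t = 1/q`. Both uses of Hölder need `1/q ≤ 1/p`.
  have h1 : ∑ Q ∈ T, (incr T m Q * μ Q ^ (1 / p)) * (m' Q * ν Q ^ (1 / t)) ≤
      Φ ^ (1 / p) * (V ^ (1 - 1 / p) * Ψ ^ (1 / t)) := by
    refine (sum_mul_rpow_le hT hV hm' hp ht0 (by rw [htq]; linarith) _).trans ?_
    gcongr
    exact sum_incr_rpow_mul_le hT μ hm hp
  have h2 : ∑ Q ∈ T, (incr T m' Q * ν Q ^ (1 / t)) * (m Q * μ Q ^ (1 / p)) ≤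
      Ψ ^ (1 / t) * (U ^ (1 / q) * Φ ^ (1 / p)) := by
    rw [hqt']
    refine (sum_mul_rpow_le hT hU hm ht1.le hp0 (by rw [← hqt']; exact hle) _).trans ?_
    gcongr
    exact sum_incr_rpow_mul_le hT ν hm' ht1.le
  calc ∑ Q ∈ T, m Q * m' Q * w Q
      ≤ 2 ^ δ * C₀ * ∑ Q ∈ T, incr T (fun Q => m Q * m' Q) Q * w Q :=
        sum_mul_le hT (hm.mul hm') hpack
    _ ≤ 2 ^ δ * C₀ * ∑ Q ∈ T, ((incr T m Q * μ Q ^ (1 / p)) * (m' Q * ν Q ^ (1 / t)) +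
          (incr T m' Q * ν Q ^ (1 / t)) * (m Q * μ Q ^ (1 / p))) := by
        gcongr with Q hQ
        refine (mul_le_mul_left (incr_mul_le hT hm hm' hQ) _).trans_eq ?_
        rw [hw]; ring
    _ ≤ 2 ^ δ * C₀ * (Φ ^ (1 / p) * (V ^ (1 - 1 / p) * Ψ ^ (1 / t)) +
          Ψ ^ (1 / t) * (U ^ (1 / q) * Φ ^ (1 / p))) := by
        rw [Finset.sum_add_distrib]
        gcongr
    _ = _ := by ring

/-- Take the last `j` before `2^(-j) K` drops below `k`; it exists because `K` is finite and `k >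
0`. -/
theorem exists_dyadic_level {k K : ℝ≥0∞} (hk : k ≠ 0) (hkK : k ≤ K) (hK : K ≠ ∞) :
    ∃ j : ℕ, k ≤ 2⁻¹ ^ j * K ∧ 2⁻¹ ^ j * K ≤ 2 * k := by
  have hex : ∃ j : ℕ, 2⁻¹ ^ j * K < k := by
    have h1 : Filter.Tendsto (fun j : ℕ => (2⁻¹ : ℝ≥0∞) ^ j * K) Filter.atTop (nhds (0 * K)) :=
      ENNReal.Tendsto.mul_const (ENNReal.tendsto_pow_atTop_nhds_zero_of_lt_one (by norm_num))
        (Or.inr hK)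
    rw [zero_mul] at h1
    exact (h1.eventually_lt_const (pos_iff_ne_zero.2 hk)).exists
  obtain ⟨i, hi⟩ : ∃ i, Nat.find hex = i + 1 := by
    refine Nat.exists_eq_succ_of_ne_zero fun h0 => ?_
    have := Nat.find_spec hex
    rw [h0, pow_zero, one_mul] at this
    exact absurd hkK this.not_ge
  refine ⟨i, not_lt.1 (Nat.find_min hex (by omega)), ?_⟩
  have h2 := (Nat.find_spec hex).le
  rw [hi, pow_succ] at h2
  calc 2⁻¹ ^ i * K = 2 * (2⁻¹ ^ i * 2⁻¹ * K) := by
        rw [mul_comm _ (2⁻¹ : ℝ≥0∞), ← mul_assoc, ← mul_assoc,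
          ENNReal.mul_inv_cancel two_ne_zero ENNReal.ofNat_ne_top, one_mul]
    _ ≤ _ := by gcongr

/-- The bound for the sum with coefficients `ρ ^ a * μ ^ b * ν ^ c * (μ ^ (1 / p) * ν ^ (1 / t))`,
where `t` is conjugate to `q`. -/
theorem sum_le_add {a b c p q t A : ℝ} (hA : 1 ≤ A) (hp : 1 ≤ p) (hpq : p ≤ q)
    (hqt : q.HolderConjugate t) (ha : a < 0) (hb : 0 < b) (hc : 0 < c)
    (h : p < q ∨ a + b + c ≤ 0) :
    ∃ C : ℝ≥0, ∀ (T : Finset (Set X)) (ρ μ ν : Measure X) (U V K : ℝ≥0∞) (m m' : Set X → ℝ≥0∞),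
      Laminar T → (∀ Q ∈ T, MeasurableSet Q) → (∀ Q ∈ T, ρ Q ≠ ∞ ∧ μ Q ≠ ∞ ∧ ν Q ≠ ∞) →
      (∀ Q ∈ T, ρ Q ≠ 0 ∧ μ Q ≠ 0 ∧ ν Q ≠ 0) →
      Carleson T ρ (ENNReal.ofReal A) → Carleson T μ U → Carleson T ν V → K ≠ ∞ →
      (∀ Q ∈ T, ρ Q ^ a * μ Q ^ b * ν Q ^ c ≤ K) → MonoOn T m → MonoOn T m' →
      ∑ Q ∈ T, m Q * m' Q * (ρ Q ^ a * μ Q ^ b * ν Q ^ c * (μ Q ^ (1 / p) * ν Q ^ (1 / t))) ≤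
        C * K * (U ^ (1 / q) + V ^ (1 - 1 / p)) *
          ((energy T μ fun Q => m Q ^ p) ^ (1 / p) * (energy T ν fun Q => m' Q ^ t) ^ (1 / t)) := by
  obtain ⟨C, hC⟩ := sum_level_le (X := X) hA hp hpq hqt ha hb hc h
  have hp0 : 0 < p := by linarith
  have ht0 : 0 < t := hqt.symm.pos
  refine ⟨2 * C, fun T ρ μ ν U V K m m' hT hmeas hfin hpos hρ hU hV hK hkK hm hm' => ?_⟩
  have hlevel : ∀ Q, ∃ j : ℕ, Q ∈ T → ρ Q ^ a * μ Q ^ b * ν Q ^ c ≤ 2⁻¹ ^ j * K ∧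
      2⁻¹ ^ j * K ≤ 2 * (ρ Q ^ a * μ Q ^ b * ν Q ^ c) := by
    intro Q
    by_cases hQ : Q ∈ T
    · obtain ⟨f1, f2, f3⟩ := hfin Q hQ
      obtain ⟨e1, e2, e3⟩ := hpos Q hQ
      obtain ⟨j, hj⟩ := exists_dyadic_level (mul_ne_zero (mul_ne_zero
        (ENNReal.rpow_pos (pos_iff_ne_zero.2 e1) f1).ne'
        (ENNReal.rpow_pos (pos_iff_ne_zero.2 e2) f2).ne')
        (ENNReal.rpow_pos (pos_iff_ne_zero.2 e3) f3).ne') (hkK Q hQ) hK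
      exact ⟨j, fun _ => hj⟩
    · exact ⟨0, fun h' => absurd h' hQ⟩
  choose J hJ using hlevel
  set B := (U ^ (1 / q) + V ^ (1 - 1 / p)) *
          ((energy T μ fun Q => m Q ^ p) ^ (1 / p) * (energy T ν fun Q => m' Q ^ t) ^ (1 / t))
    with hB
  have hone : ∀ j, ∑ Q ∈ T.filter (J · = j),
      m Q * m' Q * (ρ Q ^ a * μ Q ^ b * ν Q ^ c * (μ Q ^ (1 / p) * ν Q ^ (1 / t))) ≤
      2⁻¹ ^ j * (K * (C * B)) := by
    intro j
    have hsub : T.filter (J · = j) ⊆ T := Finset.filter_subset _ _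
    have hJj : ∀ Q ∈ T.filter (J · = j), ρ Q ^ a * μ Q ^ b * ν Q ^ c ≤ 2⁻¹ ^ j * K ∧
        2⁻¹ ^ j * K ≤ 2 * (ρ Q ^ a * μ Q ^ b * ν Q ^ c) := by
      intro Q hQ
      rw [Finset.mem_filter] at hQ
      rw [← hQ.2]
      exact hJ Q hQ.1
    have key := hC (T.filter (J · = j)) ρ μ ν U V (2⁻¹ ^ j * K) m m' (hT.subset hsub)
      (fun Q hQ => hmeas Q (hsub hQ)) (fun Q hQ => hfin Q (hsub hQ))
      (fun Q hQ => hpos Q (hsub hQ)) (hρ.subset hsub) (hU.subset hsub) (hV.subset hsub) hJj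
      (fun P hP Q hQ => hm P (hsub hP) Q (hsub hQ)) (fun P hP Q hQ => hm' P (hsub hP) Q (hsub hQ))
    calc _ ≤ ∑ Q ∈ T.filter (J · = j),
          (2⁻¹ ^ j * K) * (m Q * m' Q * (μ Q ^ (1 / p) * ν Q ^ (1 / t))) := by
          refine Finset.sum_le_sum fun Q hQ => ?_
          calc _ ≤ m Q * m' Q * (2⁻¹ ^ j * K * (μ Q ^ (1 / p) * ν Q ^ (1 / t))) :=
                mul_le_mul' le_rfl (mul_le_mul' (hJj Q hQ).1 le_rfl)
            _ = _ := by ring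
      _ = (2⁻¹ ^ j * K) * ∑ Q ∈ T.filter (J · = j),
          m Q * m' Q * (μ Q ^ (1 / p) * ν Q ^ (1 / t)) := by rw [Finset.mul_sum]
      _ ≤ (2⁻¹ ^ j * K) * (C * B) := by
          gcongr
          refine key.trans ?_
          rw [hB, mul_assoc (C : ℝ≥0∞)]
          gcongr
          · exact energy_subset hT hmeas μ (hm.rpow hp0.le) hsub
          · exact energy_subset hT hmeas ν (hm'.rpow ht0.le) hsub
      _ = _ := by ring
  calc _ = ∑ j ∈ T.image J, ∑ Q ∈ T.filter (J · = j),
        m Q * m' Q * (ρ Q ^ a * μ Q ^ b * ν Q ^ c * (μ Q ^ (1 / p) * ν Q ^ (1 / t))) :=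
        (Finset.sum_fiberwise_of_maps_to (fun Q hQ => Finset.mem_image_of_mem J hQ) _).symm
    _ ≤ ∑ j ∈ T.image J, 2⁻¹ ^ j * (K * (C * B)) := Finset.sum_le_sum fun j _ => hone j
    _ = (∑ j ∈ T.image J, 2⁻¹ ^ j) * (K * (C * B)) := by rw [Finset.sum_mul]
    _ ≤ 2 * (K * (C * B)) := by
        gcongr
        refine (ENNReal.sum_le_tsum _).trans ?_
        rw [ENNReal.tsum_geometric, ENNReal.one_sub_inv_two, inv_inv]
    _ = _ := by
        rw [hB, ENNReal.coe_mul, ENNReal.coe_ofNat]; ring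

/-- The diagonal bound by the product of the packing constants. -/
theorem sum_le_mul {p t : ℝ} (hpt : p.HolderConjugate t) {T : Finset (Set X)} {μ ν : Measure X}
    {U V : ℝ≥0∞} {m m' : Set X → ℝ≥0∞} (hT : Laminar T) (hU : Carleson T μ U)
    (hV : Carleson T ν V) (hm : MonoOn T m) (hm' : MonoOn T m') :
    ∑ Q ∈ T, m Q * m' Q * (μ Q ^ (1 / p) * ν Q ^ (1 / t)) ≤
      U ^ (1 / p) * V ^ (1 - 1 / p) *
        ((energy T μ fun Q => m Q ^ p) ^ (1 / p) * (energy T ν fun Q => m' Q ^ t) ^ (1 / t)) := by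
  have hp0 : 0 < p := hpt.pos
  have htp : 1 / t = 1 - 1 / p := by
    rw [one_div, one_div, ← hpt.inv_add_inv_eq_one]; ring
  calc _ = ∑ Q ∈ T, (m Q * μ Q ^ (1 / p)) * (m' Q * ν Q ^ (1 / t)) :=
        Finset.sum_congr rfl fun Q _ => by ring
    _ ≤ (∑ Q ∈ T, (m Q * μ Q ^ (1 / p)) ^ p) ^ (1 / p) * (V ^ (1 - 1 / p) *
        (energy T ν fun Q => m' Q ^ t) ^ (1 / t)) :=
        sum_mul_rpow_le hT hV hm' hpt.lt.le hpt.symm.pos htp.ge _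
    _ ≤ (U * energy T μ fun Q => m Q ^ p) ^ (1 / p) * (V ^ (1 - 1 / p) *
        (energy T ν fun Q => m' Q ^ t) ^ (1 / t)) := by
        gcongr
        refine le_trans (le_of_eq ?_) (sum_mul_le_energy hT hU (hm.rpow hp0.le))
        refine Finset.sum_congr rfl fun Q _ => ?_
        rw [ENNReal.mul_rpow_of_nonneg _ _ hp0.le, ← ENNReal.rpow_mul, one_div_mul_cancel hp0.ne',
          ENNReal.rpow_one]
    _ = _ := by rw [ENNReal.mul_rpow_of_nonneg _ _ (by positivity)]; ring

/-- The product of the packing constants is at most the sum of two products whose exponents average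
to those of the first. -/
theorem rpow_mul_rpow_le_add {U V : ℝ≥0∞} {x y x₁ y₁ x₂ y₂ : ℝ} (hx₁ : 0 ≤ x₁) (hx₂ : 0 ≤ x₂)
    (hy₁ : 0 ≤ y₁) (hy₂ : 0 ≤ y₂) (hx : x₁ + x₂ = 2 * x) (hy : y₁ + y₂ = 2 * y) :
    U ^ x * V ^ y ≤ U ^ x₁ * V ^ y₁ + U ^ x₂ * V ^ y₂ := by
  have h : (U ^ x * V ^ y) ^ (2 : ℝ) ≤ (U ^ x₁ * V ^ y₁ + U ^ x₂ * V ^ y₂) ^ (2 : ℝ) := by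
    calc (U ^ x * V ^ y) ^ (2 : ℝ) = (U ^ x₁ * V ^ y₁) * (U ^ x₂ * V ^ y₂) := by
          rw [ENNReal.mul_rpow_of_nonneg _ _ (by norm_num), ← ENNReal.rpow_mul, ← ENNReal.rpow_mul,
            mul_comm x, mul_comm y, ← hx, ← hy, ENNReal.rpow_add_of_nonneg _ _ hx₁ hx₂,
            ENNReal.rpow_add_of_nonneg _ _ hy₁ hy₂]
          ring
      _ ≤ (U ^ x₁ * V ^ y₁ + U ^ x₂ * V ^ y₂) * (U ^ x₁ * V ^ y₁ + U ^ x₂ * V ^ y₂) := by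
          gcongr
          · exact le_self_add
          · exact le_add_self
      _ = _ := by rw [ENNReal.rpow_two, sq]
  exact (ENNReal.rpow_le_rpow_iff (by norm_num)).1 h

end

/-! ### Cubes, dyadic nesting, and packing from sparseness -/

section

variable {n : ℕ}

theorem Cube.toSet_eq (Q : Cube n) :
    Q.toSet = Set.univ.pi fun i => Set.Ico (Q.center i - Q.half) (Q.center i + Q.half) := by
  ext y
  simp [Cube.toSet]

theorem Cube.measurableSet (Q : Cube n) : MeasurableSet Q.toSet := by
  rw [Q.toSet_eq]
  exact MeasurableSet.univ_pi fun _ => measurableSet_Ico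

theorem Cube.volume_eq (Q : Cube n) : volume Q.toSet = ∏ _i : Fin n, ENNReal.ofReal (2 * Q.half) := by
  rw [Q.toSet_eq, Real.volume_pi_Ico]
  congr 1
  funext i
  ring_nf

theorem Cube.volume_ne_zero (Q : Cube n) : volume Q.toSet ≠ 0 := by
  rw [Q.volume_eq]
  refine Finset.prod_ne_zero_iff.2 fun i _ => ?_
  have := Q.half_pos
  simp [this]

theorem Cube.volume_ne_top (Q : Cube n) : volume Q.toSet ≠ ∞ := by
  rw [Q.volume_eq]
  exact ENNReal.prod_ne_top fun i _ => ENNReal.ofReal_ne_top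

theorem Cube.center_mem (Q : Cube n) : Q.center ∈ Q.toSet := fun i => by
  have := Q.half_pos
  constructor <;> linarith

/-- Allows sums over cubes to be written as sums over the family of their point sets. In dimension
zero the half side is not determined by the set. -/
theorem Cube.toSet_injective (hn : 0 < n) : Function.Injective (Cube.toSet (n := n)) := by
  have key : ∀ P Q : Cube n, P.toSet ⊆ Q.toSet → ∀ i,
      Q.center i - Q.half ≤ P.center i - P.half ∧ P.center i + P.half ≤ Q.center i + Q.half := by
    intro P Q h i
    rw [P.toSet_eq, Q.toSet_eq, Set.pi_subset_pi_iff] at h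
    have hP := P.half_pos
    rcases h with h | h
    · have := h i (Set.mem_univ i)
      rwa [Set.Ico_subset_Ico_iff (by linarith)] at this
    · rw [← P.toSet_eq] at h
      exact absurd P.center_mem (h ▸ Set.notMem_empty _)
  intro P Q h
  have h1 := key P Q h.subset
  have h2 := key Q P h.superset
  have hhalf : P.half = Q.half := by
    have a := h1 ⟨0, hn⟩
    have b := h2 ⟨0, hn⟩
    linarith [a.1, a.2, b.1, b.2]
  refine Cube.ext ?_ hhalf
  funext i
  linarith [(h1 i).1, (h1 i).2, (h2 i).1, (h2 i).2]

theorem Cube.child_subset (Q : Cube n) (ε : Fin n → Bool) : (Q.child ε).toSet ⊆ Q.toSet := by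
  intro y hy i
  have h := hy i
  have hQ := Q.half_pos
  simp only [Cube.child] at h
  split_ifs at h <;> constructor <;> linarith [h.1, h.2]

theorem Cube.child_disjoint (Q : Cube n) {ε ε' : Fin n → Bool} (h : ε ≠ ε') :
    Disjoint (Q.child ε).toSet (Q.child ε').toSet := by
  obtain ⟨i, hi⟩ := Function.ne_iff.1 h
  rw [Set.disjoint_left]
  intro y hy hy'
  have h1 := hy i
  have h2 := hy' i
  simp only [Cube.child] at h1 h2
  cases h3 : ε i <;> cases h4 : ε' i <;> simp_all <;> linarith [h1.1, h1.2, h2.1, h2.2]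

theorem DyadicSub.exists_foldl {R Q : Cube n} (h : DyadicSub R Q) :
    ∃ l : List (Fin n → Bool), Q = l.foldl Cube.child R := by
  induction h with
  | self => exact ⟨[], rfl⟩
  | child _ ε ih =>
    obtain ⟨l, rfl⟩ := ih
    exact ⟨l ++ [ε], by simp⟩

theorem Cube.foldl_subset (l : List (Fin n → Bool)) (R : Cube n) :
    (l.foldl Cube.child R).toSet ⊆ R.toSet := by
  induction l generalizing R with
  | nil => exact subset_rfl
  | cons ε l ih => exact (ih _).trans (R.child_subset ε)

theorem Cube.foldl_nested (l l' : List (Fin n → Bool)) (R : Cube n) :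
    (l.foldl Cube.child R).toSet ⊆ (l'.foldl Cube.child R).toSet ∨
      (l'.foldl Cube.child R).toSet ⊆ (l.foldl Cube.child R).toSet ∨
      Disjoint (l.foldl Cube.child R).toSet (l'.foldl Cube.child R).toSet := by
  induction l generalizing l' R with
  | nil => exact Or.inr (Or.inl (Cube.foldl_subset l' R))
  | cons ε l ih =>
    cases l' with
    | nil => exact Or.inl (Cube.foldl_subset (ε :: l) R)
    | cons ε' l' =>
      by_cases h : ε = ε'
      · subst h
        exact ih l' (R.child ε)
      · exact Or.inr (Or.inr ((R.child_disjoint h).mono (Cube.foldl_subset l _)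
          (Cube.foldl_subset l' _)))

theorem IsDyadicLattice.laminar {D : Set (Cube n)} (hD : IsDyadicLattice D) {F : Finset (Cube n)}
    (hF : ∀ Q ∈ F, Q ∈ D) : Laminar (F.image Cube.toSet) := by
  constructor
  · intro Q hQ
    obtain ⟨Q, -, rfl⟩ := Finset.mem_image.1 hQ
    exact ⟨_, Q.center_mem⟩
  · intro P hP Q hQ hPQ
    obtain ⟨P, hPF, rfl⟩ := Finset.mem_image.1 hP
    obtain ⟨Q, hQF, rfl⟩ := Finset.mem_image.1 hQ
    obtain ⟨R, -, h1, h2⟩ := hD.common_ancestor P (hF P hPF) Q (hF Q hQF)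
    obtain ⟨l, rfl⟩ := h1.exists_foldl
    obtain ⟨l', rfl⟩ := h2.exists_foldl
    rcases Cube.foldl_nested l l' R with h | h | h
    · exact Or.inl h
    · exact Or.inr h
    · exact absurd h (Set.not_disjoint_iff_nonempty_inter.2 hPQ)

/-- Each `Q` is paid for on its own part `E Q`, and these parts are disjoint subsets of `P`. Taking
`c = 1` gives packing for Lebesgue measure; taking averages of `w`, with a maximal function as
majorant, gives packing for `w`. -/
theorem ofReal_mul_sum_le {η : ℝ} {S : Set (Cube n)} (hS : IsSparse η S) {F : Finset (Cube n)}
    (hF : ∀ Q ∈ F, Q ∈ S) (P : Cube n) {c : Cube n → ℝ≥0∞} {Φ : (Fin n → ℝ) → ℝ≥0∞}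
    (hc : ∀ Q ∈ F, ∀ x ∈ Q.toSet, c Q ≤ Φ x) (hP : ∀ Q ∈ F, Q.toSet ⊆ P.toSet) :
    ENNReal.ofReal η * ∑ Q ∈ F, Q.vol * c Q ≤ ∫⁻ x in P.toSet, Φ x := by
  obtain ⟨E, hE, hdisj⟩ := hS
  calc ENNReal.ofReal η * ∑ Q ∈ F, Q.vol * c Q
      = ∑ Q ∈ F, (ENNReal.ofReal η * Q.vol) * c Q := by
        rw [Finset.mul_sum]
        exact Finset.sum_congr rfl fun Q _ => by ring
    _ ≤ ∑ Q ∈ F, ∫⁻ x in E Q, Φ x := by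
        refine Finset.sum_le_sum fun Q hQ => ?_
        obtain ⟨h1, h2, h3⟩ := hE Q (hF Q hQ)
        calc _ ≤ volume (E Q) * c Q := by gcongr
          _ = ∫⁻ _ in E Q, c Q := by rw [setLIntegral_const, mul_comm]
          _ ≤ _ := setLIntegral_mono' h1 fun x hx => hc Q hQ x (h2 hx)
    _ = ∫⁻ x in ⋃ Q ∈ F, E Q, Φ x :=
        (lintegral_biUnion_finset (fun Q hQ Q' hQ' h => hdisj (hF Q hQ) (hF Q' hQ') h)
          (fun Q hQ => (hE Q (hF Q hQ)).1) _).symm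
    _ ≤ _ := lintegral_mono_set (Set.iUnion₂_subset fun Q hQ =>
        ((hE Q (hF Q hQ)).2.1).trans (hP Q hQ))

theorem sum_image_filter (hn : 0 < n) (F : Finset (Cube n)) (P : Cube n)
    (c : Set (Fin n → ℝ) → ℝ≥0∞) :
    ∑ Q ∈ (F.image Cube.toSet).filter (· ⊆ P.toSet), c Q =
      ∑ Q ∈ F.filter (fun Q => Q.toSet ⊆ P.toSet), c Q.toSet := by
  rw [Finset.sum_filter, Finset.sum_image (fun _ _ _ _ h => Cube.toSet_injective hn h),
    Finset.sum_filter]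

theorem IsSparse.carleson_volume (hn : 0 < n) {η : ℝ} (hη : 0 < η) {S : Set (Cube n)}
    (hS : IsSparse η S) {F : Finset (Cube n)} (hF : ∀ Q ∈ F, Q ∈ S) :
    Carleson (F.image Cube.toSet) volume (ENNReal.ofReal η⁻¹) := by
  intro R hR
  obtain ⟨P, -, rfl⟩ := Finset.mem_image.1 hR
  rw [sum_image_filter hn]
  have := ofReal_mul_sum_le hS (F := F.filter (fun Q => Q.toSet ⊆ P.toSet))
    (fun Q hQ => hF Q (Finset.mem_filter.1 hQ).1) P (c := fun _ => 1) (Φ := fun _ => 1)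
    (fun _ _ _ _ => le_rfl) (fun Q hQ => (Finset.mem_filter.1 hQ).2)
  simp only [mul_one, setLIntegral_const, one_mul] at this
  rw [ENNReal.ofReal_inv_of_pos hη, ← ENNReal.div_eq_inv_mul, ENNReal.le_div_iff_mul_le
    (Or.inl (by simpa using hη)) (Or.inl ENNReal.ofReal_ne_top), mul_comm]
  exact this

theorem lintegral_maximalFn_le {w : (Fin n → ℝ) → ℝ≥0∞} {P : Cube n} (h0 : mass w P ≠ 0)
    (hfin : mass w P ≠ ∞) :
    ∫⁻ x in P.toSet, maximalFn (P.toSet.indicator w) x ≤ ainfty w * mass w P := by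
  rw [← ENNReal.div_le_iff h0 hfin]
  refine le_trans ?_ (le_iSup _ P)
  rw [if_neg hfin]

theorem IsSparse.carleson_of_ainfty (hn : 0 < n) {η : ℝ} (hη : 0 < η) {S : Set (Cube n)}
    (hS : IsSparse η S) {F : Finset (Cube n)} (hF : ∀ Q ∈ F, Q ∈ S)
    {w : (Fin n → ℝ) → ℝ≥0∞} (h0 : ∀ Q ∈ F, mass w Q ≠ 0) (hfin : ∀ Q ∈ F, mass w Q ≠ ∞) :
    Carleson (F.image Cube.toSet) (volume.withDensity w) (ENNReal.ofReal η⁻¹ * ainfty w) := by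
  intro R hR
  obtain ⟨P, hP, rfl⟩ := Finset.mem_image.1 hR
  rw [sum_image_filter hn]
  have := ofReal_mul_sum_le hS (F := F.filter (fun Q => Q.toSet ⊆ P.toSet))
    (fun Q hQ => hF Q (Finset.mem_filter.1 hQ).1) P (c := fun Q => Q.vol⁻¹ * mass w Q)
    -- For `Q ⊆ P` the average of `w` over `Q` is that of `w χ_P`, hence at most `M(w χ_P)` on `Q`.
    -- The integral of the latter over `P` is what the `A_∞` constant bounds.
    (Φ := maximalFn (P.toSet.indicator w)) (fun Q hQ x hx => by
      have hQP := (Finset.mem_filter.1 hQ).2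
      have : mass w Q = mass (P.toSet.indicator w) Q :=
        setLIntegral_congr_fun Q.measurableSet fun y hy => by
          rw [Set.indicator_of_mem (hQP hy)]
      rw [this]
      exact le_iSup₂ (f := fun (Q : Cube n) (_ : x ∈ Q.toSet) =>
        Q.vol⁻¹ * mass (P.toSet.indicator w) Q) Q hx)
    (fun Q hQ => (Finset.mem_filter.1 hQ).2)
  replace this := this.trans (lintegral_maximalFn_le (h0 P hP) (hfin P hP))
  rw [withDensity_apply _ P.measurableSet, ENNReal.ofReal_inv_of_pos hη, mul_assoc,
    ← ENNReal.div_eq_inv_mul, ENNReal.le_div_iff_mul_le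
    (Or.inl (by simpa using hη)) (Or.inl ENNReal.ofReal_ne_top), mul_comm]
  refine le_trans (le_of_eq ?_) this
  congr 1
  refine Finset.sum_congr rfl fun Q _ => ?_
  rw [withDensity_apply _ Q.measurableSet, ← mul_assoc, Cube.vol,
    ENNReal.mul_inv_cancel Q.volume_ne_zero Q.volume_ne_top, one_mul, mass]

/-- On `P` the function `M(w χ_P)` is at least the average of `w`, so its integral is at least
`w(P)`. -/
theorem ainfty_ne_zero [Nonempty (Cube n)] {w : (Fin n → ℝ) → ℝ≥0∞}
    (h0 : ∀ Q : Cube n, mass w Q ≠ 0) : ainfty w ≠ 0 := by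
  intro h
  obtain ⟨P⟩ := ‹Nonempty (Cube n)›
  by_cases hfin : mass w P = ∞
  · have : (∞ : ℝ≥0∞) ≤ ainfty w := by
      refine le_trans ?_ (le_iSup _ P)
      rw [if_pos hfin]
    rw [h] at this
    simp at this
  · have h1 := lintegral_maximalFn_le (h0 P) hfin
    rw [h, zero_mul] at h1
    have h2 : mass w P ≤ ∫⁻ x in P.toSet, maximalFn (P.toSet.indicator w) x := by
      calc mass w P = ∫⁻ _ in P.toSet, P.vol⁻¹ * mass w P := by
            rw [setLIntegral_const, mul_comm, ← mul_assoc, Cube.vol,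
              ENNReal.mul_inv_cancel P.volume_ne_zero P.volume_ne_top, one_mul]
        _ ≤ _ := by
            refine setLIntegral_mono' P.measurableSet fun x hx => ?_
            have : mass w P = mass (P.toSet.indicator w) P :=
              setLIntegral_congr_fun P.measurableSet fun y hy => by
                rw [Set.indicator_of_mem hy]
            rw [this]
            exact le_iSup₂ (f := fun (Q : Cube n) (_ : x ∈ Q.toSet) =>
              Q.vol⁻¹ * mass (P.toSet.indicator w) Q) P hx
    exact h0 P (le_antisymm (h2.trans h1) zero_le)

end

/-! ### Change of variables for weights, and testing on one cube -/

section

variable {n : ℕ}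

theorem IsWeight.aemeasurable_ofReal {w : (Fin n → ℝ) → ℝ} (hw : IsWeight w) :
    AEMeasurable (fun x => ENNReal.ofReal (w x)) volume :=
  hw.1.aestronglyMeasurable.aemeasurable.ennreal_ofReal

theorem IsWeight.aemeasurable_wpow {w : (Fin n → ℝ) → ℝ} (hw : IsWeight w) (e : ℝ) :
    AEMeasurable (wpow w e) volume :=
  hw.aemeasurable_ofReal.pow_const e

theorem IsWeight.wpow_ne {w : (Fin n → ℝ) → ℝ} (hw : IsWeight w) (e : ℝ) :
    ∀ᵐ x, wpow w e x ≠ 0 ∧ wpow w e x ≠ ∞ := by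
  filter_upwards [hw.2] with x hx
  have h := ENNReal.ofReal_pos.2 hx
  exact ⟨(ENNReal.rpow_pos h ENNReal.ofReal_ne_top).ne',
    ENNReal.rpow_ne_top_of_ne_zero h.ne' ENNReal.ofReal_ne_top⟩

theorem IsWeight.volume_absolutelyContinuous {w : (Fin n → ℝ) → ℝ} (hw : IsWeight w) (e : ℝ) :
    volume ≪ volume.withDensity (wpow w e) :=
  withDensity_absolutelyContinuous' (hw.aemeasurable_wpow e) ((hw.wpow_ne e).mono fun _ h => h.1)

theorem IsWeight.volume_absolutelyContinuous_wmeasure {w : (Fin n → ℝ) → ℝ} (hw : IsWeight w) :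
    volume ≪ wmeasure w :=
  withDensity_absolutelyContinuous' hw.aemeasurable_ofReal
    (hw.2.mono fun _ h => (ENNReal.ofReal_pos.2 h).ne')

theorem mass_eq (w : (Fin n → ℝ) → ℝ≥0∞) (Q : Cube n) :
    volume.withDensity w Q.toSet = mass w Q :=
  withDensity_apply _ Q.measurableSet

theorem IsWeight.mass_ne_zero {w : (Fin n → ℝ) → ℝ} (hw : IsWeight w) (e : ℝ) (Q : Cube n) :
    mass (wpow w e) Q ≠ 0 := fun h => by
  rw [← mass_eq] at h
  exact Q.volume_ne_zero (hw.volume_absolutelyContinuous e h)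

/-- With `u = W ^ (t / (t - P))` this reads `u ^ (P / t) * W = u`: the dual weight is designed so
that `u ^ (1 / t)` has `L^P(W)` norm `(∫ u) ^ (1 / P)`. -/
theorem rpow_dual_mul {W : ℝ≥0∞} (h0 : W ≠ 0) (htop : W ≠ ∞) {t P : ℝ} (ht : 0 < t)
    (htP : t < P) : (W ^ (t / (t - P))) ^ (P / t) * W = W ^ (t / (t - P)) := by
  have h1 : t - P ≠ 0 := by linarith
  conv_lhs => rw [← ENNReal.rpow_mul]; enter [2]; rw [← ENNReal.rpow_one W]
  rw [← ENNReal.rpow_add _ _ h0 htop]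
  congr 1
  field_simp
  ring

/-- Change of variables: a function in `L^P(w)` corresponds to one in `L^{P/t}(u)`, where
`u = w ^ (t / (t - P))`. -/
theorem IsWeight.exists_density {w : (Fin n → ℝ) → ℝ} (hw : IsWeight w) {t P : ℝ} (ht : 0 < t)
    (htP : t < P) {u : (Fin n → ℝ) → ℝ≥0∞} (hu : u = wpow w (t / (t - P)))
    {f : (Fin n → ℝ) → ℝ} (hf : MemLp f (ENNReal.ofReal P) (wmeasure w)) :
    ∃ h : (Fin n → ℝ) → ℝ≥0∞, AEMeasurable h (volume.withDensity u) ∧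
      (∀ Q : Cube n, mass u Q ≠ ∞ → avg t Q f = Q.vol ^ (-(1 / t)) * mass u Q ^ (1 / t) *
        mean (volume.withDensity u) h Q.toSet ^ (1 / t)) ∧
      ∫⁻ x, h x ^ (P / t) ∂(volume.withDensity u) =
        eLpNorm f (ENNReal.ofReal P) (wmeasure w) ^ P := by
  have hP : 0 < P := ht.trans htP
  have hum : AEMeasurable u volume := by rw [hu]; exact hw.aemeasurable_wpow _
  have hune : ∀ᵐ x, u x ≠ 0 ∧ u x ≠ ∞ := by rw [hu]; exact hw.wpow_ne _
  have hfm : AEMeasurable (fun x => ‖f x‖ₑ) volume :=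
    (hf.1.mono_ac hw.volume_absolutelyContinuous_wmeasure).enorm
  set h : (Fin n → ℝ) → ℝ≥0∞ := fun x => ‖f x‖ₑ ^ t * (u x)⁻¹ with hh
  have hhm : AEMeasurable h volume := (hfm.pow_const t).mul hum.inv
  have hac : volume.withDensity u ≪ volume := withDensity_absolutelyContinuous _ _
  refine ⟨h, hhm.mono_ac hac, fun Q hQ => ?_, ?_⟩
  · have h1 : ∫⁻ x in Q.toSet, h x ∂(volume.withDensity u) = ∫⁻ x in Q.toSet, ‖f x‖ₑ ^ t := by
      rw [restrict_withDensity Q.measurableSet,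
        lintegral_withDensity_eq_lintegral_mul₀ hum.restrict hhm.restrict]
      refine lintegral_congr_ae (ae_restrict_of_ae ?_)
      filter_upwards [hune] with x hx
      simp only [Pi.mul_apply, hh]
      rw [mul_comm, mul_assoc, ENNReal.inv_mul_cancel hx.1 hx.2, mul_one]
    have hm0 : mass u Q ≠ 0 := by rw [hu]; exact hw.mass_ne_zero _ Q
    have ht' : 0 ≤ 1 / t := by positivity
    rw [mean, h1, mass_eq, avg, ENNReal.rpow_neg, ← ENNReal.inv_rpow,
      ← ENNReal.mul_rpow_of_nonneg _ _ ht', ← ENNReal.mul_rpow_of_nonneg _ _ ht']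
    congr 1
    rw [mul_assoc, ← mul_assoc (mass u Q), ENNReal.mul_inv_cancel hm0 hQ, one_mul]
  · rw [eLpNorm_eq_lintegral_rpow_enorm_toReal (by simpa using hP) ENNReal.ofReal_ne_top,
      ENNReal.toReal_ofReal hP.le, ← ENNReal.rpow_mul, one_div_mul_cancel hP.ne', ENNReal.rpow_one,
      wmeasure, lintegral_withDensity_eq_lintegral_mul₀ hw.aemeasurable_ofReal (hfm.pow_const P),
      lintegral_withDensity_eq_lintegral_mul₀ hum (hhm.pow_const _)]
    refine lintegral_congr_ae ?_
    filter_upwards [hune, hw.2] with x hx hwx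
    have hW := ENNReal.ofReal_pos.2 hwx
    have key := rpow_dual_mul hW.ne' ENNReal.ofReal_ne_top ht htP
    have hux : u x = ENNReal.ofReal (w x) ^ (t / (t - P)) := by rw [hu]; rfl
    rw [← hux] at key
    have hpt : 0 ≤ P / t := by positivity
    simp only [Pi.mul_apply, hh]
    rw [ENNReal.mul_rpow_of_nonneg _ _ hpt, ← ENNReal.rpow_mul, mul_div_cancel₀ _ ht.ne',
      ENNReal.inv_rpow]
    have hne0 : u x ^ (P / t) ≠ 0 := (ENNReal.rpow_pos (pos_iff_ne_zero.2 hx.1) hx.2).ne'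
    have hnetop : u x ^ (P / t) ≠ ∞ := ENNReal.rpow_ne_top_of_nonneg hpt hx.2
    calc u x * (‖f x‖ₑ ^ P * (u x ^ (P / t))⁻¹)
        = (u x ^ (P / t) * ENNReal.ofReal (w x)) * (‖f x‖ₑ ^ P * (u x ^ (P / t))⁻¹) := by rw [key]
      _ = (u x ^ (P / t) * (u x ^ (P / t))⁻¹) * (ENNReal.ofReal (w x) * ‖f x‖ₑ ^ P) := by ring
      _ = _ := by rw [ENNReal.mul_inv_cancel hne0 hnetop, one_mul]

/-- Test functions concentrated on a cube `Q`, whose masses `m k` increase to the mass of `Q`. -/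
def HasTestSequence (t : ℝ) (P : ℝ≥0∞) (θ : ℝ) (w : (Fin n → ℝ) → ℝ)
    (u : (Fin n → ℝ) → ℝ≥0∞) (Q : Cube n) : Prop :=
  ∃ (f : ℕ → (Fin n → ℝ) → ℝ) (m : ℕ → ℝ≥0∞), (∀ k, MemLp (f k) P (wmeasure w)) ∧
    (∀ k, avg t Q (f k) = (Q.vol⁻¹ * m k) ^ (1 / t)) ∧
    (∀ k, eLpNorm (f k) P (wmeasure w) ≤ m k ^ θ) ∧ (∀ k, m k ≠ ∞) ∧
    Filter.Tendsto m Filter.atTop (nhds (mass u Q))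

theorem IsWeight.hasTestSequence {w : (Fin n → ℝ) → ℝ} (hw : IsWeight w) {t P : ℝ} (ht : 0 < t)
    (htP : t < P) {u : (Fin n → ℝ) → ℝ≥0∞} (hu : u = wpow w (t / (t - P))) (Q : Cube n) :
    HasTestSequence t (ENNReal.ofReal P) (1 / P) w u Q := by
  have hP : 0 < P := ht.trans htP
  have hum : AEMeasurable u volume := by rw [hu]; exact hw.aemeasurable_wpow _
  have hune : ∀ᵐ x, u x ≠ 0 ∧ u x ≠ ∞ := by rw [hu]; exact hw.wpow_ne _
  set u' := hum.mk u with hu'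
  have hu'm : Measurable u' := hum.measurable_mk
  have hae : u =ᵐ[volume] u' := hum.ae_eq_mk
  -- Local integrability of `u` is not assumed, so the extremal function `u ^ (1 / t)` is truncated
  -- where a measurable version of `u` is at most `k`.
  set A : ℕ → Set (Fin n → ℝ) := fun k => Q.toSet ∩ {x | u' x ≤ k} with hA
  have hAm : ∀ k, MeasurableSet (A k) := fun k =>
    Q.measurableSet.inter (measurableSet_le hu'm measurable_const)
  have hAfin : ∀ k, ∀ x ∈ A k, u' x ≠ ∞ := fun k x hx =>
    ne_top_of_le_ne_top (ENNReal.natCast_ne_top k) hx.2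
  set f : ℕ → (Fin n → ℝ) → ℝ := fun k => (A k).indicator fun x => (u' x).toReal ^ (1 / t) with hf
  have hfm : ∀ k, Measurable (f k) := fun k =>
    (hu'm.ennreal_toReal.pow_const _).indicator (hAm k)
  have hfe : ∀ k (τ : ℝ), 0 < τ → ∀ x, ‖f k x‖ₑ ^ τ = (A k).indicator (fun x => u' x ^ (τ / t)) x := by
    intro k τ hτ x
    by_cases hx : x ∈ A k
    · simp only [hf, Set.indicator_of_mem hx]
      rw [Real.enorm_of_nonneg (by positivity),
        ← ENNReal.ofReal_rpow_of_nonneg ENNReal.toReal_nonneg (by positivity),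
        ENNReal.ofReal_toReal (hAfin k x hx), ← ENNReal.rpow_mul]
      congr 1
      ring
    · simp [hf, Set.indicator_of_notMem hx, hτ]
  set m : ℕ → ℝ≥0∞ := fun k => volume.withDensity u (A k) with hm
  have hm_eq : ∀ k, m k = ∫⁻ x in A k, u' x := fun k => by
    simp only [hm]
    rw [withDensity_apply _ (hAm k)]
    exact lintegral_congr_ae (ae_restrict_of_ae hae)
  have hnorm : ∀ k, eLpNorm (f k) (ENNReal.ofReal P) (wmeasure w) = m k ^ (1 / P) := by
    intro k
    rw [eLpNorm_eq_lintegral_rpow_enorm_toReal (by simpa using hP) ENNReal.ofReal_ne_top,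
      ENNReal.toReal_ofReal hP.le, wmeasure, lintegral_withDensity_eq_lintegral_mul₀
      hw.aemeasurable_ofReal ((hfm k).enorm.pow_const P).aemeasurable, hm_eq,
      ← lintegral_indicator (hAm k)]
    congr 1
    refine lintegral_congr_ae ?_
    filter_upwards [hw.2, hae] with x hwx hx
    rw [Pi.mul_apply, hfe k P hP]
    by_cases hxA : x ∈ A k
    · rw [Set.indicator_of_mem hxA, Set.indicator_of_mem hxA, ← hx, hu, mul_comm]
      exact rpow_dual_mul (ENNReal.ofReal_pos.2 hwx).ne' ENNReal.ofReal_ne_top ht htP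
    · rw [Set.indicator_of_notMem hxA, Set.indicator_of_notMem hxA, mul_zero]
  have hmfin : ∀ k, m k ≠ ∞ := by
    intro k
    rw [hm_eq]
    refine ne_top_of_le_ne_top (b := (k : ℝ≥0∞) * volume Q.toSet)
      (ENNReal.mul_ne_top (ENNReal.natCast_ne_top k) Q.volume_ne_top) ?_
    calc ∫⁻ x in A k, u' x ≤ ∫⁻ _ in A k, (k : ℝ≥0∞) := setLIntegral_mono' (hAm k) fun x hx => hx.2
      _ = k * volume (A k) := setLIntegral_const _ _
      _ ≤ _ := by gcongr; exact Set.inter_subset_left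
  refine ⟨f, m, fun k => ⟨(hfm k).aestronglyMeasurable, ?_⟩, fun k => ?_, fun k => (hnorm k).le,
    hmfin, ?_⟩
  · rw [hnorm]
    exact ENNReal.rpow_lt_top_of_nonneg (by positivity) (hmfin k)
  · rw [avg, hm_eq, ← lintegral_indicator Q.measurableSet, ← lintegral_indicator (hAm k)]
    congr 2
    refine lintegral_congr fun x => ?_
    simp only [hfe k t ht, div_self ht.ne', ENNReal.rpow_one]
    by_cases hxA : x ∈ A k
    · rw [Set.indicator_of_mem hxA.1]
    · rw [Set.indicator_of_notMem hxA]
      by_cases hxQ : x ∈ Q.toSet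
      · rw [Set.indicator_of_mem hxQ, Set.indicator_of_notMem hxA]
      · rw [Set.indicator_of_notMem hxQ]
  · have hmono : Monotone A := fun i j hij x hx =>
      ⟨hx.1, (show u' x ≤ i from hx.2).trans (by exact_mod_cast hij)⟩
    have hlim := tendsto_measure_iUnion_atTop (μ := volume.withDensity u) hmono
    have hU : volume.withDensity u (⋃ k, A k) = mass u Q := by
      rw [← mass_eq]
      refine measure_congr ?_
      have hac : volume.withDensity u ≪ volume := withDensity_absolutelyContinuous _ _
      refine hac.ae_le ?_
      filter_upwards [hune, hae] with x hx hxe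
      apply propext
      change x ∈ (⋃ k, A k) ↔ x ∈ Q.toSet
      rw [Set.mem_iUnion]
      constructor
      · rintro ⟨k, hk⟩
        exact hk.1
      · intro hxQ
        obtain ⟨k, hk⟩ := ENNReal.exists_nat_gt (hxe ▸ hx.2)
        exact ⟨k, hxQ, hk.le⟩
    rw [hU] at hlim
    exact hlim

theorem mass_one (Q : Cube n) : mass (fun _ => 1) Q = Q.vol := by
  rw [mass, setLIntegral_const, one_mul, Cube.vol]

/-- Serves `q = 1`: the indicator of `Q` has supremum norm at most one, whence the norm exponent
`0`. -/
theorem hasTestSequence_top (t : ℝ) (w : (Fin n → ℝ) → ℝ) (Q : Cube n) :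
    HasTestSequence t ∞ 0 w (fun _ => 1) Q := by
  have hle : eLpNorm (Q.toSet.indicator fun _ => (1 : ℝ)) ∞ (wmeasure w) ≤ 1 := by
    refine (eLpNorm_indicator_const_le _ _).trans ?_
    simp
  refine ⟨fun _ => Q.toSet.indicator fun _ => 1, fun _ => Q.vol, fun _ =>
    ⟨(measurable_const.indicator Q.measurableSet).aestronglyMeasurable,
      hle.trans_lt ENNReal.one_lt_top⟩, fun _ => ?_, fun _ => by simpa using hle,
    fun _ => Q.volume_ne_top, ?_⟩
  · rw [avg]
    congr 2
    have : ∀ x ∈ Q.toSet, ‖Q.toSet.indicator (fun _ => (1 : ℝ)) x‖ₑ ^ t = 1 := fun x hx => by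
      rw [Set.indicator_of_mem hx]; simp
    rw [setLIntegral_congr_fun Q.measurableSet this, setLIntegral_const, one_mul, Cube.vol]
  · rw [mass_one]
    exact tendsto_const_nhds

/-- Testing the sparse form on a single cube. -/
theorem le_of_hasTestSequence {r t α θ θ' a b c : ℝ} {P P' : ℝ≥0∞} {S : Set (Cube n)}
    {ω σ : (Fin n → ℝ) → ℝ} {u v : (Fin n → ℝ) → ℝ≥0∞} {Q : Cube n} (hQ : Q ∈ S)
    (hr : 0 < r) (ht : 0 < t) (hb : 0 < b) (hc : 0 < c) (ha : a = 1 + α - 1 / r - 1 / t)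
    (hbθ : b = 1 / r - θ) (hcθ : c = 1 / t - θ')
    (hf : HasTestSequence r P θ ω u Q) (hg : HasTestSequence t P' θ' σ v Q)
    (hu : mass u Q ≠ 0) (hv : mass v Q ≠ 0) {K : ℝ≥0∞}
    (hK : ∀ f g : (Fin n → ℝ) → ℝ, MemLp f P (wmeasure ω) → MemLp g P' (wmeasure σ) →
      sparseForm r t α S f g ≤ K * eLpNorm f P (wmeasure ω) * eLpNorm g P' (wmeasure σ)) :
    Q.vol ^ a * mass u Q ^ b * mass v Q ^ c ≤ K := by
  obtain ⟨f, m, hf1, hf2, hf3, hf4, hf5⟩ := hf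
  obtain ⟨g, l, hg1, hg2, hg3, hg4, hg5⟩ := hg
  have hV0 : Q.vol ≠ 0 := Q.volume_ne_zero
  have hVt : Q.vol ≠ ∞ := Q.volume_ne_top
  have hlim : Filter.Tendsto (fun k => Q.vol ^ a * m k ^ b * l k ^ c) Filter.atTop
      (nhds (Q.vol ^ a * mass u Q ^ b * mass v Q ^ c)) := by
    have hm := (ENNReal.continuous_rpow_const (y := b)).continuousAt.tendsto.comp hf5
    have hl := (ENNReal.continuous_rpow_const (y := c)).continuousAt.tendsto.comp hg5
    have hVa0 : Q.vol ^ a ≠ 0 := (ENNReal.rpow_pos (pos_iff_ne_zero.2 hV0) hVt).ne'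
    have hVat : Q.vol ^ a ≠ ∞ := ENNReal.rpow_ne_top_of_ne_zero hV0 hVt
    have hub : mass u Q ^ b ≠ 0 := by simp [ENNReal.rpow_eq_zero_iff, hu, hb.not_gt]
    have hvc : mass v Q ^ c ≠ 0 := by simp [ENNReal.rpow_eq_zero_iff, hv, hc.not_gt]
    -- The limits may be infinite, so nonvanishing of the factors is needed to exclude `0 * ∞`.
    refine ENNReal.Tendsto.mul (ENNReal.Tendsto.const_mul hm (Or.inr hVat))
      (Or.inl (mul_ne_zero hVa0 hub)) hl (Or.inl hvc)
  refine le_of_tendsto hlim ?_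
  filter_upwards [hf5.eventually_ne hu, hg5.eventually_ne hv] with k hmk hlk
  have h1 : avg r Q (f k) * avg t Q (g k) * Q.vol ^ (1 + α) ≤ K * m k ^ θ * l k ^ θ' := by
    calc _ ≤ sparseForm r t α S (f k) (g k) :=
          ENNReal.le_tsum (f := fun Q : S => avg r Q.1 (f k) * avg t Q.1 (g k) *
            Q.1.vol ^ (1 + α)) ⟨Q, hQ⟩
      _ ≤ _ := hK _ _ (hf1 k) (hg1 k)
      _ ≤ _ := by
          gcongr
          · exact hf3 k
          · exact hg3 k
  have hr' : 0 ≤ 1 / r := by positivity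
  have ht' : 0 ≤ 1 / t := by positivity
  have hVsplit : Q.vol ^ a = Q.vol ^ (-(1 / r)) * Q.vol ^ (-(1 / t)) * Q.vol ^ (1 + α) := by
    rw [← ENNReal.rpow_add _ _ hV0 hVt, ← ENNReal.rpow_add _ _ hV0 hVt, ha]
    ring_nf
  have hmsplit : m k ^ b = m k ^ (1 / r) * m k ^ (-θ) := by
    rw [← ENNReal.rpow_add _ _ hmk (hf4 k), hbθ]; ring_nf
  have hlsplit : l k ^ c = l k ^ (1 / t) * l k ^ (-θ') := by
    rw [← ENNReal.rpow_add _ _ hlk (hg4 k), hcθ]; ring_nf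
  have hm1 : m k ^ θ * m k ^ (-θ) = 1 := by
    rw [← ENNReal.rpow_add _ _ hmk (hf4 k)]; simp
  have hl1 : l k ^ θ' * l k ^ (-θ') = 1 := by
    rw [← ENNReal.rpow_add _ _ hlk (hg4 k)]; simp
  rw [hf2, hg2, ENNReal.mul_rpow_of_nonneg _ _ hr', ENNReal.mul_rpow_of_nonneg _ _ ht',
    ENNReal.inv_rpow, ENNReal.inv_rpow, ← ENNReal.rpow_neg, ← ENNReal.rpow_neg] at h1
  calc Q.vol ^ a * m k ^ b * l k ^ c
      = (Q.vol ^ (-(1 / r)) * m k ^ (1 / r) * (Q.vol ^ (-(1 / t)) * l k ^ (1 / t)) *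
          Q.vol ^ (1 + α)) * (m k ^ (-θ) * l k ^ (-θ')) := by
        rw [hVsplit, hmsplit, hlsplit]; ring
    _ ≤ (K * m k ^ θ * l k ^ θ') * (m k ^ (-θ) * l k ^ (-θ')) := by gcongr
    _ = K * (m k ^ θ * m k ^ (-θ)) * (l k ^ θ' * l k ^ (-θ')) := by ring
    _ = K := by rw [hm1, hl1, mul_one, mul_one]

end

/-! ### Reduction to laminar sums, and the upper bound for `q > 1` -/

section

variable {n : ℕ}

theorem twoWeightConst_le_of_mem {a b c : ℝ} {S : Set (Cube n)} {u v : (Fin n → ℝ) → ℝ≥0∞}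
    {Q : Cube n} (hQ : Q ∈ S) :
    Q.vol ^ a * mass u Q ^ b * mass v Q ^ c ≤ twoWeightConst a b c S u v :=
  le_iSup₂ (f := fun (Q : Cube n) (_ : Q ∈ S) => Q.vol ^ a * mass u Q ^ b * mass v Q ^ c) Q hQ

/-- All factors are positive, so an infinite mass would make the product infinite. Local
integrability of `u` and `v` on the cubes of `S` thus comes for free. -/
theorem mass_ne_top_of_twoWeightConst_ne_top {a b c : ℝ} {S : Set (Cube n)}
    {u v : (Fin n → ℝ) → ℝ≥0∞} (hb : 0 < b) (hc : 0 < c) {Q : Cube n} (hQ : Q ∈ S)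
    (hu : mass u Q ≠ 0) (hv : mass v Q ≠ 0) (hK : twoWeightConst a b c S u v ≠ ∞) :
    mass u Q ≠ ∞ ∧ mass v Q ≠ ∞ := by
  have hle := ne_top_of_le_ne_top hK (twoWeightConst_le_of_mem (a := a) (b := b) (c := c)
    (u := u) (v := v) hQ)
  have hVa0 : Q.vol ^ a ≠ 0 :=
    (ENNReal.rpow_pos (pos_iff_ne_zero.2 Q.volume_ne_zero) Q.volume_ne_top).ne'
  have hub : mass u Q ^ b ≠ 0 := by simp [ENNReal.rpow_eq_zero_iff, hu, hb.not_gt]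
  have hvc : mass v Q ^ c ≠ 0 := by simp [ENNReal.rpow_eq_zero_iff, hv, hc.not_gt]
  constructor
  · intro h
    apply hle
    rw [h, ENNReal.top_rpow_of_pos hb, ENNReal.mul_top hVa0, ENNReal.top_mul hvc]
  · intro h
    apply hle
    rw [h, ENNReal.top_rpow_of_pos hc, ENNReal.mul_top (mul_ne_zero hVa0 hub)]

theorem sparseForm_le_iff {r t α : ℝ} {S : Set (Cube n)} {f g : (Fin n → ℝ) → ℝ} {B : ℝ≥0∞} :
    sparseForm r t α S f g ≤ B ↔ ∀ F : Finset (Cube n), (∀ Q ∈ F, Q ∈ S) →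
      ∑ Q ∈ F, avg r Q f * avg t Q g * Q.vol ^ (1 + α) ≤ B := by
  rw [sparseForm, ENNReal.tsum_eq_iSup_sum, iSup_le_iff]
  constructor
  · intro h F hF
    refine le_trans (le_of_eq ?_) (h (F.subtype (· ∈ S)))
    exact (Finset.sum_subtype_of_mem (fun Q => avg r Q f * avg t Q g * Q.vol ^ (1 + α)) hF).symm
  · intro h F
    refine le_trans (le_of_eq ?_) (h (F.map (Function.Embedding.subtype _)) (fun Q hQ => ?_))
    · rw [Finset.sum_map]
      rfl
    · obtain ⟨Q', -, rfl⟩ := Finset.mem_map.1 hQ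
      exact Q'.2

/-- Doob's constant for the averages of order `r` in `L^p`. -/
def doobConst (r p : ℝ) : ℝ≥0∞ := (ENNReal.ofReal (p / r / (p / r - 1)) ^ (p / r)) ^ (1 / p)

theorem doobConst_ne_top {r p : ℝ} (hr : 0 < r) (hrp : r < p) : doobConst r p ≠ ∞ := by
  have hp : 0 < p := hr.trans hrp
  exact ENNReal.rpow_ne_top_of_nonneg (by positivity)
    (ENNReal.rpow_ne_top_of_nonneg (by positivity) ENNReal.ofReal_ne_top)

theorem energy_maxMean_rpow_le {F : Finset (Cube n)} (hF : Laminar (F.image Cube.toSet))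
    {u h : (Fin n → ℝ) → ℝ≥0∞} (hu0 : ∀ Q ∈ F, mass u Q ≠ 0) (hu : ∀ Q ∈ F, mass u Q ≠ ∞)
    (hh : AEMeasurable h (volume.withDensity u)) {r p : ℝ} (hr : 0 < r) (hrp : r < p)
    {N : ℝ≥0∞} (hN : ∫⁻ x, h x ^ (p / r) ∂(volume.withDensity u) = N ^ p) :
    (energy (F.image Cube.toSet) (volume.withDensity u) fun Q =>
      (maxMean (F.image Cube.toSet) (volume.withDensity u) h Q ^ (1 / r)) ^ p) ^ (1 / p) ≤
      doobConst r p * N := by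
  have hp : 0 < p := hr.trans hrp
  have hpr : 1 < p / r := by rwa [lt_div_iff₀ hr, one_mul]
  have hmeas : ∀ R ∈ F.image Cube.toSet, MeasurableSet R := fun R hR => by
    obtain ⟨Q, -, rfl⟩ := Finset.mem_image.1 hR
    exact Q.measurableSet
  have key := energy_maxMean_le hF hmeas (μ := volume.withDensity u)
    (fun R hR => by
      obtain ⟨Q, hQ, rfl⟩ := Finset.mem_image.1 hR
      rw [mass_eq]; exact hu0 Q hQ)
    (fun R hR => by
      obtain ⟨Q, hQ, rfl⟩ := Finset.mem_image.1 hR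
      rw [mass_eq]; exact hu Q hQ) hh hpr
  rw [hN] at key
  simp only [← ENNReal.rpow_mul, one_div_mul_eq_div]
  refine (ENNReal.rpow_le_rpow key (by positivity : 0 ≤ 1 / p)).trans (le_of_eq ?_)
  rw [ENNReal.mul_rpow_of_nonneg _ _ (by positivity), ← ENNReal.rpow_mul N,
    mul_one_div_cancel hp.ne', ENNReal.rpow_one, doobConst]

/-- Reduction of the sparse form to sums over finite laminar families of sets. -/
theorem sparseForm_le_of_sum_le (hn : 0 < n) {r p τ t α a b c : ℝ} {D S : Set (Cube n)}
    (hD : IsDyadicLattice D) (hSD : S ⊆ D) {ω σ : (Fin n → ℝ) → ℝ} (hω : IsWeight ω)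
    (hσ : IsWeight σ) {u v : (Fin n → ℝ) → ℝ≥0∞} (hu : u = wpow ω (r / (r - p)))
    (hv : v = wpow σ (τ / (τ - t))) (hr : 0 < r) (hrp : r < p) (hτ : 0 < τ) (hτt : τ < t)
    (ha : a = 1 + α - 1 / r - 1 / τ) (hb : b = 1 / r - 1 / p) (hc : c = 1 / τ - 1 / t)
    (hutop : ∀ Q ∈ S, mass u Q ≠ ∞) (hvtop : ∀ Q ∈ S, mass v Q ≠ ∞) {G : ℝ≥0∞}
    (hsum : ∀ F : Finset (Cube n), (∀ Q ∈ F, Q ∈ S) → ∀ m m' : Set (Fin n → ℝ) → ℝ≥0∞,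
      MonoOn (F.image Cube.toSet) m → MonoOn (F.image Cube.toSet) m' →
      ∑ Q ∈ F.image Cube.toSet, m Q * m' Q *
        (volume Q ^ a * volume.withDensity u Q ^ b * volume.withDensity v Q ^ c *
          (volume.withDensity u Q ^ (1 / p) * volume.withDensity v Q ^ (1 / t))) ≤
        G * ((energy (F.image Cube.toSet) (volume.withDensity u) fun Q => m Q ^ p) ^ (1 / p) *
          (energy (F.image Cube.toSet) (volume.withDensity v) fun Q => m' Q ^ t) ^ (1 / t)))
    {f g : (Fin n → ℝ) → ℝ} (hf : MemLp f (ENNReal.ofReal p) (wmeasure ω))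
    (hg : MemLp g (ENNReal.ofReal t) (wmeasure σ)) :
    sparseForm r τ α S f g ≤ G * (doobConst r p * doobConst τ t) *
      eLpNorm f (ENNReal.ofReal p) (wmeasure ω) * eLpNorm g (ENNReal.ofReal t) (wmeasure σ) := by
  have hp : 0 < p := hr.trans hrp
  have ht : 0 < t := hτ.trans hτt
  have hu0 : ∀ Q, mass u Q ≠ 0 := fun Q => hu ▸ hω.mass_ne_zero _ Q
  have hv0 : ∀ Q, mass v Q ≠ 0 := fun Q => hv ▸ hσ.mass_ne_zero _ Q
  obtain ⟨h, hh1, hh2, hh3⟩ := hω.exists_density hr hrp hu hf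
  obtain ⟨k, hk1, hk2, hk3⟩ := hσ.exists_density hτ hτt hv hg
  rw [sparseForm_le_iff]
  intro F hF
  have hlam : Laminar (F.image Cube.toSet) := hD.laminar fun Q hQ => hSD (hF Q hQ)
  set T := F.image Cube.toSet with hT
  set μ := volume.withDensity u with hμ
  set ν := volume.withDensity v with hν
  set m : Set (Fin n → ℝ) → ℝ≥0∞ := fun Q => maxMean T μ h Q ^ (1 / r) with hm
  set m' : Set (Fin n → ℝ) → ℝ≥0∞ := fun Q => maxMean T ν k Q ^ (1 / τ) with hm'
  have hr' : 0 ≤ 1 / r := by positivity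
  have hτ' : 0 ≤ 1 / τ := by positivity
  calc ∑ Q ∈ F, avg r Q f * avg τ Q g * Q.vol ^ (1 + α)
      ≤ ∑ Q ∈ F, m Q.toSet * m' Q.toSet *
        (volume Q.toSet ^ a * μ Q.toSet ^ b * ν Q.toSet ^ c *
          (μ Q.toSet ^ (1 / p) * ν Q.toSet ^ (1 / t))) := by
        refine Finset.sum_le_sum fun Q hQ => ?_
        have hQT : Q.toSet ∈ T := Finset.mem_image_of_mem _ hQ
        have hVa : volume Q.toSet ^ a =
            Q.vol ^ (-(1 / r)) * Q.vol ^ (-(1 / τ)) * Q.vol ^ (1 + α) := by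
          rw [Cube.vol, ← ENNReal.rpow_add _ _ Q.volume_ne_zero Q.volume_ne_top,
            ← ENNReal.rpow_add _ _ Q.volume_ne_zero Q.volume_ne_top, ha]
          congr 1
          ring
        have hμb : mass u Q ^ (1 / r) = μ Q.toSet ^ b * μ Q.toSet ^ (1 / p) := by
          rw [hμ, mass_eq, ← ENNReal.rpow_add _ _ (hu0 Q) (hutop Q (hF Q hQ)), hb]
          congr 1
          ring
        have hνc : mass v Q ^ (1 / τ) = ν Q.toSet ^ c * ν Q.toSet ^ (1 / t) := by
          rw [hν, mass_eq, ← ENNReal.rpow_add _ _ (hv0 Q) (hvtop Q (hF Q hQ)), hc]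
          congr 1
          ring
        rw [hh2 Q (hutop Q (hF Q hQ)), hk2 Q (hvtop Q (hF Q hQ)), hVa, hμb, hνc]
        calc _ ≤ Q.vol ^ (-(1 / r)) * (μ Q.toSet ^ b * μ Q.toSet ^ (1 / p)) * m Q.toSet *
              (Q.vol ^ (-(1 / τ)) * (ν Q.toSet ^ c * ν Q.toSet ^ (1 / t)) * m' Q.toSet) *
              Q.vol ^ (1 + α) := by
              gcongr
              · exact ENNReal.rpow_le_rpow (mean_le_maxMean _ _ hQT) hr'
              · exact ENNReal.rpow_le_rpow (mean_le_maxMean _ _ hQT) hτ'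
          _ = _ := by ring
    _ = ∑ Q ∈ T, m Q * m' Q *
        (volume Q ^ a * μ Q ^ b * ν Q ^ c * (μ Q ^ (1 / p) * ν Q ^ (1 / t))) := by
        rw [hT, Finset.sum_image fun _ _ _ _ h => Cube.toSet_injective hn h]
    _ ≤ G * ((energy T μ fun Q => m Q ^ p) ^ (1 / p) *
          (energy T ν fun Q => m' Q ^ t) ^ (1 / t)) :=
        hsum F hF m m' ((maxMean_mono T μ h).rpow hr') ((maxMean_mono T ν k).rpow hτ')
    _ ≤ G * ((doobConst r p * eLpNorm f (ENNReal.ofReal p) (wmeasure ω)) *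
          (doobConst τ t * eLpNorm g (ENNReal.ofReal t) (wmeasure σ))) := by
        gcongr
        · exact energy_maxMean_rpow_le hlam (fun Q _ => hu0 Q) (fun Q hQ => hutop Q (hF Q hQ))
            hh1 hr hrp hh3
        · exact energy_maxMean_rpow_le hlam (fun Q _ => hv0 Q) (fun Q hQ => hvtop Q (hF Q hQ))
            hk1 hτ hτt hk3
    _ = _ := by ring

theorem ofReal_mul_rpow_le {z x : ℝ} (hz : 1 ≤ z) (hx0 : 0 ≤ x) (hx1 : x ≤ 1) (U : ℝ≥0∞) :
    (ENNReal.ofReal z * U) ^ x ≤ ENNReal.ofReal z * U ^ x := by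
  rw [ENNReal.mul_rpow_of_nonneg _ _ hx0]
  gcongr
  have : 1 ≤ ENNReal.ofReal z := by rwa [ENNReal.one_le_ofReal]
  calc ENNReal.ofReal z ^ x ≤ ENNReal.ofReal z ^ (1 : ℝ) :=
        ENNReal.rpow_le_rpow_of_exponent_le this hx1
    _ = _ := ENNReal.rpow_one _

/-- The upper bound for `q > 1`; here `t` is conjugate to `q` and `τ` to `s`. -/
theorem exists_sparseForm_le (hn : 0 < n) {r p q τ t α a b c η : ℝ} (hp : 1 ≤ p) (hpq : p ≤ q)
    (hqt : q.HolderConjugate t) (hr : 0 < r) (hrp : r < p) (hτ : 0 < τ) (hτt : τ < t)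
    (hη : 0 < η) (hη' : η < 1) (hα : 1 / p - 1 / q ≤ α) (ha0 : a < 0)
    (ha : a = 1 + α - 1 / r - 1 / τ) (hb : b = 1 / r - 1 / p) (hc : c = 1 / τ - 1 / t) :
    ∃ C : ℝ≥0, ∀ (D S : Set (Cube n)) (ω σ : (Fin n → ℝ) → ℝ) (u v : (Fin n → ℝ) → ℝ≥0∞),
      IsDyadicLattice D → S ⊆ D → IsSparse η S → IsWeight ω → IsWeight σ →
      u = wpow ω (r / (r - p)) → v = wpow σ (τ / (τ - t)) →
      twoWeightConst a b c S u v ≠ ∞ → ∀ f g : (Fin n → ℝ) → ℝ,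
      MemLp f (ENNReal.ofReal p) (wmeasure ω) → MemLp g (ENNReal.ofReal t) (wmeasure σ) →
      sparseForm r τ α S f g ≤ C * twoWeightConst a b c S u v *
        ainftyFactor p q α (ainfty u) (ainfty v) *
        eLpNorm f (ENNReal.ofReal p) (wmeasure ω) * eLpNorm g (ENNReal.ofReal t) (wmeasure σ) := by
  have hp0 : 0 < p := by linarith
  have ht0 : 0 < t := hqt.symm.pos
  have hq0 : 0 < q := hqt.pos
  have hηinv : 1 ≤ η⁻¹ := (one_le_inv₀ hη).2 hη'.le
  have hb0 : 0 < b := by rw [hb, sub_pos]; exact one_div_lt_one_div_of_lt hr hrp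
  have hc0 : 0 < c := by rw [hc, sub_pos]; exact one_div_lt_one_div_of_lt hτ hτt
  have htq : 1 / t = 1 - 1 / q := by
    rw [one_div, one_div, ← hqt.inv_add_inv_eq_one]; ring
  have h1p : 1 / p ≤ 1 := (div_le_one hp0).2 hp
  have h1p0 : 0 < 1 / p := by positivity
  have h1q : 1 / q ≤ 1 := (div_le_one hq0).2 hqt.lt.le
  have hdoob : doobConst r p * doobConst τ t ≠ ∞ :=
    ENNReal.mul_ne_top (doobConst_ne_top hr hrp) (doobConst_ne_top hτ hτt)
  have hmain : ∃ C : ℝ≥0, ∀ (T : Finset (Set (Fin n → ℝ))) (ρ μ ν : Measure (Fin n → ℝ))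
      (U V K : ℝ≥0∞) (m m' : Set (Fin n → ℝ) → ℝ≥0∞),
      Laminar T → (∀ Q ∈ T, MeasurableSet Q) → (∀ Q ∈ T, ρ Q ≠ ∞ ∧ μ Q ≠ ∞ ∧ ν Q ≠ ∞) →
      (∀ Q ∈ T, ρ Q ≠ 0 ∧ μ Q ≠ 0 ∧ ν Q ≠ 0) →
      Carleson T ρ (ENNReal.ofReal η⁻¹) → Carleson T μ (ENNReal.ofReal η⁻¹ * U) →
      Carleson T ν (ENNReal.ofReal η⁻¹ * V) → K ≠ ∞ →
      (∀ Q ∈ T, ρ Q ^ a * μ Q ^ b * ν Q ^ c ≤ K) → MonoOn T m → MonoOn T m' →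
      ∑ Q ∈ T, m Q * m' Q * (ρ Q ^ a * μ Q ^ b * ν Q ^ c * (μ Q ^ (1 / p) * ν Q ^ (1 / t))) ≤
        C * K * ainftyFactor p q α U V *
          ((energy T μ fun Q => m Q ^ p) ^ (1 / p) * (energy T ν fun Q => m' Q ^ t) ^ (1 / t)) := by
    -- In this case `a + b + c = α > 0` with no gap between `p` and `q`, so the level-set packing is
    -- not available. Hölder with both packing constants replaces it.
    by_cases hcase : p = q ∧ 0 < α
    · obtain ⟨rfl, hα0⟩ := hcase
      refine ⟨(η⁻¹ * η⁻¹).toNNReal, fun T ρ μ ν U V K m m' hT _ _ _ _ hU hV _ hkK hm hm' => ?_⟩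
      calc _ ≤ ∑ Q ∈ T, K * (m Q * m' Q * (μ Q ^ (1 / p) * ν Q ^ (1 / t))) := by
            refine Finset.sum_le_sum fun Q hQ => ?_
            calc _ ≤ m Q * m' Q * (K * (μ Q ^ (1 / p) * ν Q ^ (1 / t))) :=
                  mul_le_mul' le_rfl (mul_le_mul' (hkK Q hQ) le_rfl)
              _ = _ := by ring
        _ = K * ∑ Q ∈ T, m Q * m' Q * (μ Q ^ (1 / p) * ν Q ^ (1 / t)) := by rw [Finset.mul_sum]
        _ ≤ K * ((ENNReal.ofReal η⁻¹ * U) ^ (1 / p) * (ENNReal.ofReal η⁻¹ * V) ^ (1 - 1 / p) *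
            ((energy T μ fun Q => m Q ^ p) ^ (1 / p) *
              (energy T ν fun Q => m' Q ^ t) ^ (1 / t))) := by
            gcongr
            exact sum_le_mul hqt hT hU hV hm hm'
        _ ≤ K * ((ENNReal.ofReal η⁻¹ * U ^ (1 / p)) * (ENNReal.ofReal η⁻¹ * V ^ (1 - 1 / p)) *
            ((energy T μ fun Q => m Q ^ p) ^ (1 / p) *
              (energy T ν fun Q => m' Q ^ t) ^ (1 / t))) := by
            gcongr
            · exact ofReal_mul_rpow_le hηinv h1p0.le h1p U
            · exact ofReal_mul_rpow_le hηinv (by linarith) (by linarith) V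
        _ = ((η⁻¹ * η⁻¹).toNNReal : ℝ≥0∞) * K * (U ^ (1 / p) * V ^ (1 - 1 / p)) *
            ((energy T μ fun Q => m Q ^ p) ^ (1 / p) *
              (energy T ν fun Q => m' Q ^ t) ^ (1 / t)) := by
            change _ = ENNReal.ofReal (η⁻¹ * η⁻¹) * K * _ * _
            rw [ENNReal.ofReal_mul (by positivity)]
            ring
        _ ≤ _ := by
            gcongr
            rw [ainftyFactor, if_pos ⟨rfl, hα0⟩]
            have e : 1 / p ^ 2 = (1 / p) ^ 2 := by rw [div_pow, one_pow]
            -- The exponents of `U` in the two terms add up to `2 / p`, those of `V` to `2 (1 - 1 /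
            -- p)`.
            refine rpow_mul_rpow_le_add ?_ ?_ ?_ ?_ ?_ ?_
            · nlinarith
            · positivity
            · positivity
            · rw [e]; nlinarith
            · rw [e]; ring
            · rw [e]; ring
    · have h : p < q ∨ a + b + c ≤ 0 := by
        rcases hpq.eq_or_lt with rfl | h
        · right
          have hα0 : ¬ 0 < α := fun h => hcase ⟨rfl, h⟩
          rw [ha, hb, hc, htq]
          linarith
        · exact Or.inl h
      obtain ⟨C, hC⟩ := sum_le_add (X := Fin n → ℝ) hηinv hp hpq hqt ha0 hb0 hc0 h
      refine ⟨C * (η⁻¹).toNNReal,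
        fun T ρ μ ν U V K m m' hT hmeas hfin hpos hρ hU hV hK hkK hm hm' => ?_⟩
      refine (hC T ρ μ ν _ _ K m m' hT hmeas hfin hpos hρ hU hV hK hkK hm hm').trans ?_
      rw [ainftyFactor, if_neg hcase, ENNReal.coe_mul]
      calc _ ≤ C * K * (ENNReal.ofReal η⁻¹ * U ^ (1 / q) + ENNReal.ofReal η⁻¹ * V ^ (1 - 1 / p)) *
            ((energy T μ fun Q => m Q ^ p) ^ (1 / p) *
              (energy T ν fun Q => m' Q ^ t) ^ (1 / t)) := by
            gcongr
            · exact ofReal_mul_rpow_le hηinv (by positivity) h1q U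
            · exact ofReal_mul_rpow_le hηinv (by linarith) (by linarith) V
        _ = _ := by
            change _ = C * ENNReal.ofReal η⁻¹ * K * _ * _
            ring
  obtain ⟨C, hC⟩ := hmain
  refine ⟨C * (doobConst r p * doobConst τ t).toNNReal,
    fun D S ω σ u v hD hSD hS hω hσ hu hv hK f g hf hg => ?_⟩
  have hu0 : ∀ Q, mass u Q ≠ 0 := fun Q => hu ▸ hω.mass_ne_zero _ Q
  have hv0 : ∀ Q, mass v Q ≠ 0 := fun Q => hv ▸ hσ.mass_ne_zero _ Q
  have hfin : ∀ Q ∈ S, mass u Q ≠ ∞ ∧ mass v Q ≠ ∞ := fun Q hQ =>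
    mass_ne_top_of_twoWeightConst_ne_top hb0 hc0 hQ (hu0 Q) (hv0 Q) hK
  rw [ENNReal.coe_mul, ENNReal.coe_toNNReal hdoob]
  refine (sparseForm_le_of_sum_le hn hD hSD hω hσ hu hv hr hrp hτ hτt ha hb hc
    (fun Q hQ => (hfin Q hQ).1) (fun Q hQ => (hfin Q hQ).2)
    (G := C * twoWeightConst a b c S u v * ainftyFactor p q α (ainfty u) (ainfty v))
    (fun F hF m m' hm hm' => ?_) hf hg).trans (le_of_eq (by ring))
  refine hC _ volume _ _ _ _ _ m m' (hD.laminar fun Q hQ => hSD (hF Q hQ)) ?_ ?_ ?_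
    (hS.carleson_volume hn hη hF)
    (hS.carleson_of_ainfty hn hη hF (fun Q _ => hu0 Q) (fun Q hQ => (hfin Q (hF Q hQ)).1))
    (hS.carleson_of_ainfty hn hη hF (fun Q _ => hv0 Q) (fun Q hQ => (hfin Q (hF Q hQ)).2))
    hK ?_ hm hm'
  all_goals
    intro R hR
    obtain ⟨Q, hQ, rfl⟩ := Finset.mem_image.1 hR
  · exact Q.measurableSet
  · rw [mass_eq, mass_eq]
    exact ⟨Q.volume_ne_top, hfin Q (hF Q hQ)⟩
  · rw [mass_eq, mass_eq]
    exact ⟨Q.volume_ne_zero, hu0 Q, hv0 Q⟩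
  · rw [mass_eq, mass_eq]
    exact twoWeightConst_le_of_mem (hF Q hQ)

end

/-! ### The case `q = 1`, conjugate exponents, and the two inequalities -/

section

variable {n : ℕ}

theorem avg_le_eLpNorm_top {τ : ℝ} (hτ : 0 < τ) {σ : (Fin n → ℝ) → ℝ} (hσ : IsWeight σ)
    (g : (Fin n → ℝ) → ℝ) (Q : Cube n) : avg τ Q g ≤ eLpNorm g ∞ (wmeasure σ) := by
  set N := eLpNorm g ∞ (wmeasure σ) with hN
  have h1 : ∀ᵐ x, ‖g x‖ₑ ≤ N := by
    refine hσ.volume_absolutelyContinuous_wmeasure.ae_le ?_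
    rw [hN, eLpNorm_exponent_top]
    exact enorm_ae_le_eLpNormEssSup g (wmeasure σ)
  have h2 : ∫⁻ x in Q.toSet, ‖g x‖ₑ ^ τ ≤ N ^ τ * Q.vol := by
    rw [Cube.vol, ← setLIntegral_const]
    refine lintegral_mono_ae (ae_restrict_of_ae (h1.mono fun x hx => ?_))
    exact ENNReal.rpow_le_rpow hx hτ.le
  calc avg τ Q g ≤ (Q.vol⁻¹ * (N ^ τ * Q.vol)) ^ (1 / τ) := by
        rw [avg]
        gcongr
    _ = (N ^ τ) ^ (1 / τ) := by
        rw [mul_comm (N ^ τ), ← mul_assoc, Cube.vol,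
          ENNReal.inv_mul_cancel Q.volume_ne_zero Q.volume_ne_top,
          one_mul]
    _ = N := by rw [← ENNReal.rpow_mul, mul_one_div_cancel hτ.ne', ENNReal.rpow_one]

/-- For `p = q = 1` both branches contain the term `U`, the exponents of `V` being `0`. -/
theorem le_ainftyFactor_one (α : ℝ) (U V : ℝ≥0∞) : U ≤ ainftyFactor 1 1 α U V := by
  rw [ainftyFactor]
  split_ifs <;> simp

/-- The upper bound for `q = 1`. -/
theorem exists_sparseForm_le_one (hn : 0 < n) {r τ α a b c η : ℝ} (hr : 0 < r) (hr1 : r < 1)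
    (hτ : 0 < τ) (hη : 0 < η) (ha : a = 1 + α - 1 / r - 1 / τ) (hb : b = 1 / r - 1)
    (hc : c = 1 / τ) :
    ∃ C : ℝ≥0, ∀ (D S : Set (Cube n)) (ω σ : (Fin n → ℝ) → ℝ) (u v : (Fin n → ℝ) → ℝ≥0∞),
      IsDyadicLattice D → S ⊆ D → IsSparse η S → IsWeight ω → IsWeight σ →
      u = wpow ω (r / (r - 1)) → v = (fun _ => 1) →
      twoWeightConst a b c S u v ≠ ∞ → ∀ f g : (Fin n → ℝ) → ℝ,
      MemLp f (ENNReal.ofReal 1) (wmeasure ω) →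
      sparseForm r τ α S f g ≤ C * twoWeightConst a b c S u v *
        ainftyFactor 1 1 α (ainfty u) (ainfty v) *
        eLpNorm f (ENNReal.ofReal 1) (wmeasure ω) * eLpNorm g ∞ (wmeasure σ) := by
  have hdoob := doobConst_ne_top hr hr1
  have hb0 : 0 < b := by
    have := one_div_lt_one_div_of_lt hr hr1
    rw [hb]; linarith
  have hc0 : 0 < c := by rw [hc]; positivity
  refine ⟨(η⁻¹).toNNReal * (doobConst r 1).toNNReal,
    fun D S ω σ u v hD hSD hS hω hσ hu hv hK f g hf => ?_⟩
  have hu0 : ∀ Q, mass u Q ≠ 0 := fun Q => hu ▸ hω.mass_ne_zero _ Q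
  have hvQ : ∀ Q, mass v Q = Q.vol := fun Q => by rw [hv, mass_one]
  have hfin : ∀ Q ∈ S, mass u Q ≠ ∞ := fun Q hQ =>
    (mass_ne_top_of_twoWeightConst_ne_top hb0 hc0 hQ (hu0 Q)
      (by rw [hvQ]; exact Q.volume_ne_zero) hK).1
  obtain ⟨h, hh1, hh2, hh3⟩ := hω.exists_density hr hr1 hu hf
  rw [sparseForm_le_iff]
  intro F hF
  have hlam : Laminar (F.image Cube.toSet) := hD.laminar fun Q hQ => hSD (hF Q hQ)
  set T := F.image Cube.toSet with hT
  set μ := volume.withDensity u with hμ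
  set K := twoWeightConst a b c S u v with hKdef
  set N := eLpNorm g ∞ (wmeasure σ) with hN
  set m : Set (Fin n → ℝ) → ℝ≥0∞ := fun Q => maxMean T μ h Q ^ (1 / r) with hm
  have hr' : 0 ≤ 1 / r := by positivity
  have hmono : MonoOn T m := (maxMean_mono T μ h).rpow hr'
  have hen : energy T μ m ≤ doobConst r 1 * eLpNorm f (ENNReal.ofReal 1) (wmeasure ω) := by
    have := energy_maxMean_rpow_le hlam (fun Q _ => hu0 Q) (fun Q hQ => hfin Q (hF Q hQ))
      hh1 hr hr1 hh3
    simpa only [ENNReal.rpow_one, div_one] using this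
  calc ∑ Q ∈ F, avg r Q f * avg τ Q g * Q.vol ^ (1 + α)
      ≤ ∑ Q ∈ F, N * K * (m Q.toSet * μ Q.toSet) := by
        refine Finset.sum_le_sum fun Q hQ => ?_
        have hQT : Q.toSet ∈ T := Finset.mem_image_of_mem _ hQ
        -- Since `v = 1`, the factor `v(Q) ^ c` is a power of `|Q|` and completes the homogeneity.
        have hVa : Q.vol ^ a * Q.vol ^ c = Q.vol ^ (-(1 / r)) * Q.vol ^ (1 + α) := by
          rw [Cube.vol, ← ENNReal.rpow_add _ _ Q.volume_ne_zero Q.volume_ne_top,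
            ← ENNReal.rpow_add _ _ Q.volume_ne_zero Q.volume_ne_top, ha, hc]
          congr 1
          ring
        have hμb : mass u Q ^ (1 / r) = mass u Q ^ b * mass u Q := by
          conv_rhs => enter [2]; rw [← ENNReal.rpow_one (mass u Q)]
          rw [← ENNReal.rpow_add _ _ (hu0 Q) (hfin Q (hF Q hQ)), hb]
          congr 1
          ring
        rw [hh2 Q (hfin Q (hF Q hQ)), hμb]
        calc _ ≤ Q.vol ^ (-(1 / r)) * (mass u Q ^ b * mass u Q) * m Q.toSet * N *
              Q.vol ^ (1 + α) := by
              gcongr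
              · exact ENNReal.rpow_le_rpow (mean_le_maxMean _ _ hQT) hr'
              · exact avg_le_eLpNorm_top hτ hσ g Q
          _ = N * (Q.vol ^ (-(1 / r)) * Q.vol ^ (1 + α) * mass u Q ^ b) *
              (m Q.toSet * mass u Q) := by ring
          _ = N * (Q.vol ^ a * mass u Q ^ b * mass v Q ^ c) * (m Q.toSet * mass u Q) := by
              rw [← hVa, hvQ]; ring
          _ ≤ _ := by
              rw [hμ, mass_eq]
              gcongr
              exact twoWeightConst_le_of_mem (hF Q hQ)
    _ = N * K * ∑ Q ∈ T, m Q * μ Q := by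
        rw [hT, Finset.sum_image fun _ _ _ _ h => Cube.toSet_injective hn h, Finset.mul_sum]
    _ ≤ N * K * ((ENNReal.ofReal η⁻¹ * ainfty u) *
          (doobConst r 1 * eLpNorm f (ENNReal.ofReal 1) (wmeasure ω))) := by
        gcongr
        refine (sum_mul_le_energy hlam (hS.carleson_of_ainfty hn hη hF (fun Q _ => hu0 Q)
          (fun Q hQ => hfin Q (hF Q hQ))) hmono).trans ?_
        gcongr
    _ ≤ N * K * ((ENNReal.ofReal η⁻¹ * ainftyFactor 1 1 α (ainfty u) (ainfty v)) *
          (doobConst r 1 * eLpNorm f (ENNReal.ofReal 1) (wmeasure ω))) := by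
        gcongr
        exact le_ainftyFactor_one _ _ _
    _ = _ := by
        rw [ENNReal.coe_mul, ENNReal.coe_toNNReal hdoob]
        change _ = ENNReal.ofReal η⁻¹ * _ * K * _ * _ * _
        ring

theorem toReal_conjExponent_pos {s : ℝ≥0∞} (hs : 1 < s) :
    0 < (ENNReal.conjExponent s).toReal ∧
      1 / (ENNReal.conjExponent s).toReal = 1 - (s⁻¹).toReal := by
  have h := ENNReal.HolderConjugate.conjExponent hs.le
  have hne : ENNReal.conjExponent s ≠ ∞ := by
    rw [ENNReal.conjExponent]
    exact ENNReal.add_ne_top.2 ⟨ENNReal.one_ne_top, ENNReal.inv_ne_top.2 (tsub_pos_of_lt hs).ne'⟩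
  have hne0 : ENNReal.conjExponent s ≠ 0 := by
    rw [ENNReal.conjExponent]
    exact (zero_lt_one.trans_le le_self_add).ne'
  have hs0 : s ≠ 0 := (zero_lt_one.trans hs).ne'
  refine ⟨ENNReal.toReal_pos hne0 hne, ?_⟩
  have hsum : s⁻¹ + (ENNReal.conjExponent s)⁻¹ = 1 := by
    have := h.inv_add_inv_eq_inv
    simpa using this
  have := congrArg ENNReal.toReal hsum
  rw [ENNReal.toReal_add (ENNReal.inv_ne_top.2 hs0) (ENNReal.inv_ne_top.2 hne0),
    ENNReal.toReal_inv (ENNReal.conjExponent s), ENNReal.toReal_one] at this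
  rw [one_div]
  linarith

theorem toReal_inv_lt {q : ℝ} {s : ℝ≥0∞} (hq : 0 < q) (hqs : ENNReal.ofReal q < s) :
    (s⁻¹).toReal < 1 / q := by
  rw [one_div, ← ENNReal.toReal_ofReal (inv_nonneg.2 hq.le), ENNReal.ofReal_inv_of_pos hq]
  exact (ENNReal.toReal_lt_toReal (ENNReal.inv_ne_top.2 (zero_le.trans_lt hqs).ne')
    (ENNReal.inv_ne_top.2 (by simpa using hq))).2 (ENNReal.inv_lt_inv.2 hqs)

theorem conjExponent_ofReal {q t : ℝ} (h : q.HolderConjugate t) :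
    ENNReal.conjExponent (ENNReal.ofReal q) = ENNReal.ofReal t := by
  have := h.ennrealOfReal
  exact ENNReal.HolderConjugate.conjExponent_eq

/-- Excludes `0 * ∞` on the right-hand side when the two-weight constant is infinite. -/
theorem ainftyFactor_ne_zero {p q α : ℝ} (hp : 1 ≤ p) (hpq : p ≤ q) {U V : ℝ≥0∞} (hU : U ≠ 0)
    (hV : V ≠ 0) : ainftyFactor p q α U V ≠ 0 := by
  have hp0 : 0 < p := by linarith
  have hq0 : 0 < q := by linarith
  have h1p : 1 / p ≤ 1 := (div_le_one hp0).2 hp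
  have h1p0 : 0 < 1 / p := by positivity
  have h1q0 : 0 < 1 / q := by positivity
  have hpos : ∀ (W : ℝ≥0∞) (x : ℝ), W ≠ 0 → 0 ≤ x → W ^ x ≠ 0 := fun W x hW hx => by
    simp [ENNReal.rpow_eq_zero_iff, hW, hx.not_gt]
  rw [ainftyFactor]
  split_ifs with h
  · have h1 := mul_ne_zero (hpos U (1 - (1 - 1 / p) ^ 2) hU (by nlinarith))
      (hpos V ((1 - 1 / p) ^ 2) hV (by positivity))
    exact fun h0 => h1 (add_eq_zero.1 h0).1
  · exact fun h0 => hpos U (1 / q) hU h1q0.le (add_eq_zero.1 h0).1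

theorem twoWeightConst_le_bestConst {r p q α a b c : ℝ} {s : ℝ≥0∞} (hp : 1 ≤ p) (hpq : p ≤ q)
    (hqs : ENNReal.ofReal q < s) (hr : 0 < r) (hrp : r < p) (ha : a = α - 1 / r + (s⁻¹).toReal)
    (hb : b = 1 / r - 1 / p) (hc : c = 1 / q - (s⁻¹).toReal) {S : Set (Cube n)}
    {ω σ : (Fin n → ℝ) → ℝ} {u v : (Fin n → ℝ) → ℝ≥0∞} (hω : IsWeight ω) (hσ : IsWeight σ)
    (hu : u = wpow ω (r / (r - p)))
    (hv : v = wpow σ (dualPower (ENNReal.conjExponent s)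
      (ENNReal.conjExponent (ENNReal.ofReal q)))) :
    twoWeightConst a b c S u v ≤ bestConst r p q s α S ω σ := by
  have hq0 : 0 < q := by linarith
  have hs1 : 1 < s := lt_of_le_of_lt (ENNReal.one_le_ofReal.2 (hp.trans hpq)) hqs
  obtain ⟨hτ, hτinv⟩ := toReal_conjExponent_pos hs1
  have hsq := toReal_inv_lt hq0 hqs
  set τ := (ENNReal.conjExponent s).toReal with hτdef
  have hb0 : 0 < b := by rw [hb, sub_pos]; exact one_div_lt_one_div_of_lt hr hrp
  have hc0 : 0 < c := by rw [hc, sub_pos]; exact hsq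
  have hu0 : ∀ Q, mass u Q ≠ 0 := fun Q => hu ▸ hω.mass_ne_zero _ Q
  have hv0 : ∀ Q, mass v Q ≠ 0 := fun Q => hv ▸ hσ.mass_ne_zero _ Q
  refine iSup₂_le fun Q hQ => le_sInf fun K hK => ?_
  have hg : HasTestSequence τ (ENNReal.conjExponent (ENNReal.ofReal q)) (1 - 1 / q) σ v Q := by
    rcases (hp.trans hpq).eq_or_lt with rfl | hq1
    · have htop : ENNReal.conjExponent (ENNReal.ofReal 1) = ∞ := by
        simp [ENNReal.conjExponent]
      have hv1 : v = fun _ => 1 := by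
        rw [hv, htop, dualPower, if_pos rfl]
        funext x
        rw [wpow, ENNReal.rpow_zero]
      rw [htop, hv1, div_one, sub_self]
      exact hasTestSequence_top τ σ Q
    · have hconj := Real.HolderConjugate.conjExponent hq1
      set t := q.conjExponent
      have ht : 0 < t := hconj.symm.pos
      have htq : 1 - 1 / q = 1 / t := by
        rw [one_div, one_div, ← hconj.inv_add_inv_eq_one]; ring
      have hτt : τ < t := by
        refine (one_div_lt_one_div ht hτ).1 ?_
        rw [← htq, hτinv]
        linarith
      rw [conjExponent_ofReal hconj, htq]
      refine hσ.hasTestSequence hτ hτt ?_ Q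
      rw [hv, conjExponent_ofReal hconj, dualPower, if_neg ENNReal.ofReal_ne_top,
        ENNReal.toReal_ofReal ht.le]
  exact le_of_hasTestSequence hQ hr hτ hb0 hc0 (by rw [ha, hτinv]; ring) hb
    (by rw [hc, hτinv]; ring) (hω.hasTestSequence hr hrp hu Q) hg (hu0 Q) (hv0 Q) hK

theorem exists_bestConst_le (hn : 0 < n) {r p q α η : ℝ} {s : ℝ≥0∞} (hp : 1 ≤ p) (hpq : p ≤ q)
    (hqs : ENNReal.ofReal q < s) (hr : 0 < r) (hrp : r < p) (hα : 1 / p - 1 / q ≤ α)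
    (hα' : α < 1 / r - (s⁻¹).toReal) (hη : 0 < η) (hη' : η < 1) :
    ∃ C : ℝ≥0, ∀ (D S : Set (Cube n)) (ω σ : (Fin n → ℝ) → ℝ) (u v : (Fin n → ℝ) → ℝ≥0∞),
      IsDyadicLattice D → S ⊆ D → IsSparse η S → IsWeight ω → IsWeight σ →
      u = wpow ω (r / (r - p)) →
      v = wpow σ (dualPower (ENNReal.conjExponent s)
        (ENNReal.conjExponent (ENNReal.ofReal q))) →
      twoWeightConst (α - 1 / r + (s⁻¹).toReal) (1 / r - 1 / p) (1 / q - (s⁻¹).toReal) S u v ≠ ∞ →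
      bestConst r p q s α S ω σ ≤ C * twoWeightConst (α - 1 / r + (s⁻¹).toReal) (1 / r - 1 / p)
        (1 / q - (s⁻¹).toReal) S u v * ainftyFactor p q α (ainfty u) (ainfty v) := by
  have hq0 : 0 < q := by linarith
  have hs1 : 1 < s := lt_of_le_of_lt (ENNReal.one_le_ofReal.2 (hp.trans hpq)) hqs
  obtain ⟨hτ, hτinv⟩ := toReal_conjExponent_pos hs1
  have hsq := toReal_inv_lt hq0 hqs
  set τ := (ENNReal.conjExponent s).toReal with hτdef
  rcases (hp.trans hpq).eq_or_lt with rfl | hq1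
  · obtain rfl : p = 1 := le_antisymm hpq hp
    have htop : ENNReal.conjExponent (ENNReal.ofReal 1) = ∞ := by
      simp [ENNReal.conjExponent]
    obtain ⟨C, hC⟩ := exists_sparseForm_le_one hn (τ := τ) (α := α)
      (a := α - 1 / r + (s⁻¹).toReal) (b := 1 / r - 1 / 1) (c := 1 / 1 - (s⁻¹).toReal) hr hrp hτ hη
      (by rw [hτinv]; ring) (by rw [div_one]) (by rw [hτinv, div_one])
    refine ⟨C, fun D S ω σ u v hD hSD hS hω hσ hu hv hK => sInf_le fun f g hf _ => ?_⟩
    have hv1 : v = fun _ => 1 := by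
      rw [hv, htop, dualPower, if_pos rfl]
      funext x
      rw [wpow, ENNReal.rpow_zero]
    rw [htop]
    exact hC D S ω σ u v hD hSD hS hω hσ hu hv1 hK f g hf
  · have hconj := Real.HolderConjugate.conjExponent hq1
    set t := q.conjExponent
    have ht : 0 < t := hconj.symm.pos
    have htq : 1 - 1 / q = 1 / t := by
      rw [one_div, one_div, ← hconj.inv_add_inv_eq_one]; ring
    have hτt : τ < t := by
      refine (one_div_lt_one_div ht hτ).1 ?_
      rw [← htq, hτinv]
      linarith
    obtain ⟨C, hC⟩ := exists_sparseForm_le hn (α := α) (a := α - 1 / r + (s⁻¹).toReal)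
      (b := 1 / r - 1 / p) (c := 1 / q - (s⁻¹).toReal) hp hpq hconj hr hrp hτ hτt hη hη' hα
      (by linarith) (by rw [hτinv]; ring) rfl (by rw [hτinv, ← htq]; ring)
    refine ⟨C, fun D S ω σ u v hD hSD hS hω hσ hu hv hK => sInf_le fun f g hf hg => ?_⟩
    rw [conjExponent_ofReal hconj] at hg hv ⊢
    refine hC D S ω σ u v hD hSD hS hω hσ hu ?_ hK f g hf hg
    rw [hv, dualPower, if_neg ENNReal.ofReal_ne_top, ENNReal.toReal_ofReal ht.le]

end

end SparseForm

end

/-! ### The theorem -/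

theorem theorem3 (n : ℕ) (hn : 0 < n) (r p q : ℝ) (s : ℝ≥0∞) (α η : ℝ)
    (hp : 1 ≤ p) (hpq : p ≤ q) (hqs : ENNReal.ofReal q < s) (hr : 0 < r) (hrp : r < p)
    (hα : 1 / p - 1 / q ≤ α) (hα' : α < 1 / r - (s⁻¹).toReal)
    (hη : 0 < η) (hη' : η < 1) :
    ∃ C : ℝ≥0, ∀ (D S : Set (SparseForm.Cube n)) (ω σ : (Fin n → ℝ) → ℝ)
      (u v : (Fin n → ℝ) → ℝ≥0∞),
      SparseForm.IsDyadicLattice D → S ⊆ D → SparseForm.IsSparse η S →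
      SparseForm.IsWeight ω → SparseForm.IsWeight σ →
      u = SparseForm.wpow ω (r / (r - p)) →
      v = SparseForm.wpow σ (SparseForm.dualPower (ENNReal.conjExponent s)
        (ENNReal.conjExponent (ENNReal.ofReal q))) →
      (SparseForm.bestConst r p q s α S ω σ < ∞ →
        SparseForm.MemTwoWeight (α - 1 / r + (s⁻¹).toReal) (1 / r - 1 / p)
          (1 / q - (s⁻¹).toReal) S u v) ∧
      SparseForm.twoWeightConst (α - 1 / r + (s⁻¹).toReal) (1 / r - 1 / p)
          (1 / q - (s⁻¹).toReal) S u v ≤ SparseForm.bestConst r p q s α S ω σ ∧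
      SparseForm.bestConst r p q s α S ω σ ≤
        C * SparseForm.twoWeightConst (α - 1 / r + (s⁻¹).toReal) (1 / r - 1 / p)
            (1 / q - (s⁻¹).toReal) S u v *
          SparseForm.ainftyFactor p q α (SparseForm.ainfty u) (SparseForm.ainfty v) := by
  obtain ⟨C, hC⟩ := SparseForm.exists_bestConst_le hn hp hpq hqs hr hrp hα hα' hη hη'
  -- Adding one makes the constant nonzero, so the right-hand side is `∞` whenever the two-weight
  -- constant is.
  refine ⟨C + 1, fun D S ω σ u v hD hSD hS hω hσ hu hv => ?_⟩
  have hlow := SparseForm.twoWeightConst_le_bestConst hp hpq hqs hr hrp rfl rfl rfl (S := S)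
    hω hσ hu hv (α := α)
  refine ⟨fun h => hlow.trans_lt h, hlow, ?_⟩
  by_cases hK : SparseForm.twoWeightConst (α - 1 / r + (s⁻¹).toReal) (1 / r - 1 / p)
      (1 / q - (s⁻¹).toReal) S u v = ∞
  · have : Nonempty (SparseForm.Cube n) := ⟨⟨0, 1, one_pos⟩⟩
    have hU := SparseForm.ainfty_ne_zero (w := u) fun Q => hu ▸ hω.mass_ne_zero _ Q
    have hV := SparseForm.ainfty_ne_zero (w := v) fun Q => hv ▸ hσ.mass_ne_zero _ Q
    rw [hK, ENNReal.mul_top (by simp), ENNReal.top_mul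
      (SparseForm.ainftyFactor_ne_zero hp hpq hU hV)]
    exact le_top
  · refine (hC D S ω σ u v hD hSD hS hω hσ hu hv hK).trans ?_
    gcongr
    simp
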